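/- **Setting.** Let $(X_i,U_i)_{i\ge 0}$ be an iid sequence with $X_i\in\mathbb R^K$, $U_i\ge 0$, where one component of $X_i$ is the constant $1$, $E|X_i|^2<\infty$ and $E[X_iX_i']$ is nonsingular. Let $\beta\in\mathbb R^K$ and $Y_i=\exp(X_i'\beta)U_i$. Fix $\delta>0$. In the multiplicative case (MP) put $e_i(\varphi)=Y_i\exp(-X_i'\varphi)-1$ and $w_i(\varphi)=1-\frac{Y_i\exp(-X_i'\varphi)}{1+\delta}$. In the additive case (AP) put $e_i(\varphi)=Y_i-\exp(X_i'\varphi)$ and $w_i(\varphi)=1-\frac{\exp(X_i'\varphi)}{1+\delta}$. In particular $w_i(\beta)=1-\frac{U_i}{1+\delta}$ for MP and $w_i(\beta)=1-\frac{\exp(X_i'\beta)}{1+\delta}$ for AP. In both cases let $$c_i(\delta,\varphi)=\log\bigl(\delta+Y_i\exp(-X_i'\varphi)\bigr)-\tfrac1{1+\delta}e_i(\varphi),\qquad \tilde Y_i(\varphi)=\log\bigl(Y_i+\delta\exp(X_i'\varphi)\bigr)-c_i(\delta,\varphi).$$ The iOLS iteration on a sample of size $n$, with $n\times K$ covariate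 matrix $X$, is $\hat\beta_{t+1}=\hat M_n(\hat\beta_t)$ with $\hat M_n(\varphi)=(X'X)^{-1}X'\tilde Y(\varphi)$, and $M(\varphi)=E[X_iX_i']^{-1}E[X_i\tilde Y_i(\varphi)]$ is its population counterpart. A Poisson estimate is, for MP, a solution $b$ of $\sum_iX_i(Y_i\exp(-X_i'b)-1)=0$, and, for AP (PPML), a maximizer $b$ of $\sum_i\bigl(Y_iX_i'b-\exp(X_i'b)\bigr)$. **Assumptions.** For MP assume $E[X_i(U_i-1)]=0$; for AP assume $E[X_i(Y_i-\exp(X_i'\beta))]=0$. Write $\eta_i=e_i(\beta)/(1+\delta)$ and assume $E|X_i\eta_i|^2<\infty$. For an invertible $K\times K$ matrix $L$ write $|a|_L=|La|$; for $L=E[X_iX_i']^{1/2}$ this is the Euclidean norm in coordinates in which the covariates are prewhitened. Call a ball $B_0=\{\varphi:|\varphi-\beta|_L\le r\}$, $r>0$, *regular* if $E\bigl[\sup_{\varphi\in B_0}|w_i(\varphi)|\,|X_i|^2\bigr]<\infty$. **Theorem.** The following holds for MP and for AP. 1. *(Poisson estimates.)* In every sample with $Y_i\ge0$ and $X$ of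 full column rank, $b$ is a fixed point of $\hat M_n$ if and only if $b$ is a Poisson estimate, and every limit of iOLS iterates, from any starting point, is a Poisson estimate. 2. *(Sufficient condition for a contraction.)* If $B_0$ is regular, $w_i(\beta)\ge0$ almost surely and $E[(1-w_i(\beta))X_iX_i']$ is positive definite, then there are $\kappa\in(0,1)$ and $r'>0$ such that, for $L'=E[X_iX_i']^{1/2}$ up to an orthogonal factor on the left, the ball $\{|\varphi-\beta|_{L'}\le r'\}$ lies in $B_0$ and $M$ is a contraction with modulus $\kappa$ on it in the norm $|\cdot|_{L'}$. 3. *(Asymptotics.)* Let $B_0$ be a regular ball on which $M$ is a contraction with modulus $\kappa\in(0,1)$ in the norm $|\cdot|_L$, and let the initial estimates $\hat\beta_0=\hat\beta_0(n)$ be random vectors with $P(\hat\beta_0\in B_0)\to1$. Then with probability tending to one the iterates $\hat\beta_t$ converge as $t\to\infty$ to the Poisson estimate, which is unique. The matrix $A=E[(1-w_i(\beta))X_iX_i']$ is positive definite. For every sequence of integers $t(n)\ge-\frac12\log(n)/\log(\kappa)$, as $n\to\infty$, $$\hat\beta_{t(n)}\overset{p}{\to}\beta,\qquad n^{1/2}|\hat\beta_{t(n)}-\beta|=O_p(1),\qquad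 \sqrt n\,(\hat\beta_{t(n)}-\beta)\overset{d}{\to}\mathcal N(0,\Omega),\qquad \Omega=A^{-1}\Sigma_0A^{-1},$$ where $\Sigma_0$ is the covariance matrix of $X_i\eta_i$. Moreover $\Omega$ is consistently estimated by $$\hat\Omega=\bigl(\tfrac1nX'(I-W)X\bigr)^{-1}\hat\Sigma_0\bigl(\tfrac1nX'(I-W)X\bigr)^{-1},$$ where $\hat\Sigma_0$ is any consistent estimator of $\Sigma_0$ and $W$ is the diagonal matrix with entries $w_i(\beta)$, or $w_i(\tilde\beta)$ for any $\tilde\beta\overset{p}{\to}\beta$, such as $\tilde\beta=\hat\beta_{t(n)}$. -/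

import Mathlib

open MeasureTheory ProbabilityTheory Filter Topology

noncomputable section

namespace IOLS

/-- Column vectors of `ℝ^K` with the Euclidean norm. -/
abbrev Vec (K : ℕ) : Type := EuclideanSpace ℝ (Fin K)

/-- The two versions of the Poisson model: multiplicative (`MP`) and additive (`AP`, i.e. PPML). -/
inductive Form where
  | MP
  | AP

/-- The error of one observation with response `y` and linear index `z = x'φ`:
`y exp(-z) - 1` (that is `U - 1` at the true index) in the multiplicative model,
`y - exp z` in the additive model. -/
def err : Form → ℝ → ℝ → ℝ
  | .MP, y, z => y * Real.exp (-z) - 1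
  | .AP, y, z => y - Real.exp z

/-- The observation-specific correction
`c_i(δ,φ) = log(δ + Y_i exp(-X_i'φ)) - (1+δ)⁻¹ (error of observation i at φ)`. -/
def correction (v : Form) (δ y z : ℝ) : ℝ :=
  Real.log (δ + y * Real.exp (-z)) - 1 / (1 + δ) * err v y z

/-- The transformed response `log(Y_i + δ exp(X_i'φ)) - c_i(δ,φ)`. -/
def transformed (v : Form) (δ y z : ℝ) : ℝ :=
  Real.log (y + δ * Real.exp z) - correction v δ y z

/-- The diagonal weight of one observation; it is the derivative of `transformed v δ y z` in `z`
(for `y ≥ 0`, `δ > 0`). At the true parameter it is `1 - U_i/(1+δ)` for `MP` and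
`1 - exp(X_i'β)/(1+δ)` for `AP`. -/
def weight : Form → ℝ → ℝ → ℝ → ℝ
  | .MP, δ, y, z => 1 - y * Real.exp (-z) / (1 + δ)
  | .AP, δ, _, z => 1 - Real.exp z / (1 + δ)

/-! ### Sample quantities: `n` observations with covariates `x i` and responses `y i` -/

/-- The `n × K` matrix whose rows are the covariate vectors. -/
def design {n K : ℕ} (x : Fin n → Vec K) : Matrix (Fin n) (Fin K) ℝ :=
  Matrix.of fun i k => x i k

/-- One iteration `φ ↦ (X'X)⁻¹ X' Ỹ(φ)`: the OLS regression of the transformed response on `X`. -/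
def step {n K : ℕ} (v : Form) (δ : ℝ) (x : Fin n → Vec K) (y : Fin n → ℝ) (φ : Vec K) : Vec K :=
  WithLp.toLp 2 ((((design x).transpose * design x)⁻¹).mulVec
    ((design x).transpose.mulVec fun i => transformed v δ (y i) (inner ℝ (x i) φ)))

/-- The `t`-th iOLS iterate started at `b₀`. -/
def iter {n K : ℕ} (v : Form) (δ : ℝ) (x : Fin n → Vec K) (y : Fin n → ℝ) (b₀ : Vec K) (t : ℕ) :
    Vec K :=
  (step v δ x y)^[t] b₀

/-- The Poisson pseudo log-likelihood, up to the term `log (y!)` that is free of the parameter. -/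
def pseudoLogLik {n K : ℕ} (x : Fin n → Vec K) (y : Fin n → ℝ) (b : Vec K) : ℝ :=
  ∑ i, (y i * inner ℝ (x i) b - Real.exp (inner ℝ (x i) b))

/-- `b` is a Poisson regression estimate: for `MP`, it solves the sample moment condition
`∑ X_i (Y_i exp(-X_i'b) - 1) = 0`; for `AP`, it is a PPML estimate, i.e. it maximizes the Poisson
pseudo log-likelihood. -/
def IsPoissonEstimate {n K : ℕ} (v : Form) (x : Fin n → Vec K) (y : Fin n → ℝ) (b : Vec K) : Prop :=
  match v with
  | .MP => ∑ i, (y i * Real.exp (-inner ℝ (x i) b) - 1) • x i = 0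
  | .AP => IsMaxOn (pseudoLogLik x y) Set.univ b

/-- The matrix `n⁻¹ X'(I - W)X`, with the diagonal weights in `W` evaluated at `φ`. -/
def bread {n K : ℕ} (v : Form) (δ : ℝ) (x : Fin n → Vec K) (y : Fin n → ℝ) (φ : Vec K) :
    Matrix (Fin K) (Fin K) ℝ :=
  (n : ℝ)⁻¹ • ((design x).transpose *
    (1 - Matrix.diagonal fun i => weight v δ (y i) (inner ℝ (x i) φ)) * design x)

/-- The sandwich `A⁻¹ S A⁻¹`. -/
def sandwich {K : ℕ} (A S : Matrix (Fin K) (Fin K) ℝ) : Matrix (Fin K) (Fin K) ℝ :=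
  A⁻¹ * S * A⁻¹

/-! ### Population quantities: one observation `(X, Y)` on a probability space -/

section Population

variable {Ω : Type*} [MeasurableSpace Ω] {K : ℕ}

/-- The response `Y = exp(X'β) U`. -/
def response (β : Vec K) (X : Ω → Vec K) (U : Ω → ℝ) (ω : Ω) : ℝ :=
  Real.exp (inner ℝ (X ω) β) * U ω

/-- `E[XX']`. -/
def secondMoment (μ : Measure Ω) (X : Ω → Vec K) : Matrix (Fin K) (Fin K) ℝ :=
  Matrix.of fun k l => ∫ ω, X ω k * X ω l ∂μ

/-- The population mapping `M(φ) = E[XX']⁻¹ E[X Ỹ(φ)]`. -/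
def popMap (v : Form) (δ : ℝ) (μ : Measure Ω) (X : Ω → Vec K) (Y : Ω → ℝ) (φ : Vec K) : Vec K :=
  WithLp.toLp 2 ((secondMoment μ X)⁻¹.mulVec
    fun k => ∫ ω, X ω k * transformed v δ (Y ω) (inner ℝ (X ω) φ) ∂μ)

/-- The score `X η` at the parameter `φ`, where `η` is the error of the transformed model
`Ỹ(φ) = X'φ + η`: `η = (U - 1)/(1+δ)` for `MP` and `η = (Y - exp(X'φ))/(1+δ)` for `AP`
when `φ` is the true parameter. -/
def score (v : Form) (δ : ℝ) (X : Ω → Vec K) (Y : Ω → ℝ) (φ : Vec K) (ω : Ω) : Vec K :=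
  (err v (Y ω) (inner ℝ (X ω) φ) / (1 + δ)) • X ω

/-- The covariance matrix `Σ₀` of the score. -/
def scoreCov (v : Form) (δ : ℝ) (μ : Measure Ω) (X : Ω → Vec K) (Y : Ω → ℝ) (φ : Vec K) :
    Matrix (Fin K) (Fin K) ℝ :=
  Matrix.of fun k l =>
    covariance (fun ω => score v δ X Y φ ω k) (fun ω => score v δ X Y φ ω l) μ

/-- The population counterpart `E[(1 - W_i) X_i X_i']` of `n⁻¹ X'(I - W)X`. -/
def popBread (v : Form) (δ : ℝ) (μ : Measure Ω) (X : Ω → Vec K) (Y : Ω → ℝ) (φ : Vec K) :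
    Matrix (Fin K) (Fin K) ℝ :=
  Matrix.of fun k l => ∫ ω, (1 - weight v δ (Y ω) (inner ℝ (X ω) φ)) * (X ω k * X ω l) ∂μ

/-- The asymptotic covariance `Ω = E[(1-W_i)X_iX_i']⁻¹ Σ₀ E[(1-W_i)X_iX_i']⁻¹`. -/
def asympCov (v : Form) (δ : ℝ) (μ : Measure Ω) (X : Ω → Vec K) (Y : Ω → ℝ) (φ : Vec K) :
    Matrix (Fin K) (Fin K) ℝ :=
  sandwich (popBread v δ μ X Y φ) (scoreCov v δ μ X Y φ)

/-- The closed ball `{φ : |L(φ - β)| ≤ r}`: a Euclidean ball after the linear change of coordinates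
`L` (`L` the identity gives the Euclidean ball, `L = E[XX']^{1/2}` the ball for prewhitened
covariates). -/
def ball (L : Vec K ≃L[ℝ] Vec K) (β : Vec K) (r : ℝ) : Set (Vec K) :=
  {φ | ‖L (φ - β)‖ ≤ r}

/-- `M` is a contraction with modulus `κ` on `B`, in the Euclidean metric after the linear change of
coordinates `L`. -/
def IsContractionOn (L : Vec K ≃L[ℝ] Vec K) (κ : ℝ) (M : Vec K → Vec K) (B : Set (Vec K)) : Prop :=
  ∀ φ ∈ B, ∀ ψ ∈ B, ‖L (M φ - M ψ)‖ ≤ κ * ‖L (φ - ψ)‖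

/-- `E[sup_{φ ∈ B} |X ∇_φ Ỹ(φ)'|] < ∞`; here `X ∇_φ Ỹ(φ)'` is the matrix `W(φ) X X'`. -/
def DominatedOn (v : Form) (δ : ℝ) (μ : Measure Ω) (X : Ω → Vec K) (Y : Ω → ℝ) (B : Set (Vec K)) :
    Prop :=
  ∃ g : Ω → ℝ, Integrable g μ ∧
    ∀ᵐ ω ∂μ, ∀ φ ∈ B, ‖X ω‖ ^ 2 * |weight v δ (Y ω) (inner ℝ (X ω) φ)| ≤ g ω

/-- The event `P n` has probability tending to one. -/
def WithProbTendingToOne (μ : Measure Ω) (P : ℕ → Ω → Prop) : Prop :=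
  Tendsto (fun n => μ {ω | ¬ P n ω}) atTop (𝓝 0)

/-- `Z n = O_p(1)` as `n → ∞`. -/
def IsBoundedInProb (μ : Measure Ω) (Z : ℕ → Ω → ℝ) : Prop :=
  ∀ ε : ℝ, 0 < ε → ∃ C : ℝ, ∀ᶠ n in atTop, μ {ω | C < |Z n ω|} ≤ ENNReal.ofReal ε

/-- Entrywise convergence in probability of random matrices to a constant matrix. -/
def MatrixTendstoInProb (μ : Measure Ω) (A : ℕ → Ω → Matrix (Fin K) (Fin K) ℝ)
    (A₀ : Matrix (Fin K) (Fin K) ℝ) : Prop :=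
  ∀ k l, TendstoInMeasure μ (fun n ω => A n ω k l) atTop (fun _ => A₀ k l)

end Population

end IOLS

end

/-! For nonnegative responses the logarithms in the transformed response cancel (`transformed_eq`):
it equals the linear index plus the error divided by `1 + δ`. An iOLS step is therefore a
preconditioned gradient step, `φ ↦ φ - Q⁻¹ G(φ)`, where `G` is the average of `grad`, i.e. minus the
score, and `Q` the average of `XX'`. Its fixed points are the roots of the Poisson score, and its
derivative is `I - Q⁻¹D(φ)` with `D(φ)` the average of `(1 - w(φ))XX'`. The same holds for `M` with
expectations.

A uniform law of large numbers makes the sample map `C¹`-close to `M` on the ball, with probability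
tending to one. Closeness carries the contraction over to the sample map (`exists_uniform_rate`):
there is a fixed point near `β` that attracts all starting points of the ball geometrically.
Expanding the score around `β` at this root gives `b - β ≈ D(β)⁻¹(-G(β))`
(`IsSampling.isEquivalent_root`), and the central limit theorem gives the sandwich covariance.

The delicate point is the number of iterations: `t(n) ≥ -½ log n / log κ` only yields `√n κ ^ t(n) ≤
1`, whereas the iterates must be within `o(n^{-1/2})` of the root. The constant regressor resolves
this. Moving the intercept multiplies `D` by a factor `τ`, so `I - τQ⁻¹D(β)` has norm at most `κ`
for all `τ` near `1`, and the parallelogram law then forces the norm at `τ = 1` strictly below `κ`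
(`IsRegular.exists_lt_modulus`). The sample iterations eventually contract at some rate `q < κ`, and
`√n q ^ t(n) → 0`.

For the sufficient condition, in the inner product given by `E[XX']` the derivative at `β`
represents the symmetric form `E[w X X']`. Nonnegative weights make it nonnegative, positive
definiteness of `D(β)` keeps it below a multiple less than one of the inner product, and
Cauchy–Schwarz for this form bounds its norm. -/

namespace IOLS

/-! ### Convergence in probability as convergence along a filter -/

section ProbOne

variable {Ω : Type*} [MeasurableSpace Ω]

/-- The filter on `ℕ × Ω` of the sets whose sections have probability tending to one: limits in
probability to constants are limits along this filter. -/
def probOne (μ : Measure Ω) : Filter (ℕ × Ω) where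
  sets := {s | Tendsto (fun n => μ {ω | (n, ω) ∉ s}) atTop (𝓝 0)}
  univ_sets := by simp
  sets_of_superset := by
    intro s t hs hst
    refine tendsto_of_tendsto_of_tendsto_of_le_of_le tendsto_const_nhds hs (fun _ => zero_le)
      fun n => measure_mono fun ω hω h => hω (hst h)
  inter_sets := by
    intro s t hs ht
    have := Tendsto.add hs ht
    rw [add_zero] at this
    refine tendsto_of_tendsto_of_tendsto_of_le_of_le tendsto_const_nhds this (fun _ => zero_le)
      fun n => (measure_mono ?_).trans (measure_union_le _ _)
    intro ω hω
    by_cases h : (n, ω) ∈ s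
    · exact Or.inr fun h' => hω ⟨h, h'⟩
    · exact Or.inl h

variable {μ : Measure Ω}

theorem eventually_probOne {p : ℕ × Ω → Prop} :
    (∀ᶠ x in probOne μ, p x) ↔ WithProbTendingToOne μ fun n ω => p (n, ω) := Iff.rfl

theorem tendsto_fst_probOne : Tendsto Prod.fst (probOne μ) atTop := by
  refine tendsto_atTop.2 fun m => ?_
  rw [eventually_probOne]
  refine tendsto_const_nhds.congr' ?_
  filter_upwards [eventually_ge_atTop m] with n hn
  simp [hn]

/-- An event of probability tending to one contains an actual sample. This lets deterministic facts
about population functions be extracted from laws of large numbers. -/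
instance [IsProbabilityMeasure μ] : (probOne μ).NeBot := by
  refine ⟨fun h => ?_⟩
  have : (∅ : Set (ℕ × Ω)) ∈ probOne μ := by rw [h]; trivial
  have h1 : Tendsto (fun _ : ℕ => μ Set.univ) atTop (𝓝 0) := by
    convert this using 1
    simp [probOne, Filter.mem_mk]
  simp at h1

theorem tendstoInMeasure_iff_probOne {E : Type*} [PseudoMetricSpace E] {f : ℕ → Ω → E} {c : E} :
    TendstoInMeasure μ f atTop (fun _ => c) ↔
      Tendsto (fun x : ℕ × Ω => f x.1 x.2) (probOne μ) (𝓝 c) := by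
  rw [tendstoInMeasure_iff_dist, Metric.tendsto_nhds]
  refine forall₂_congr fun ε _ => ?_
  rw [eventually_probOne, WithProbTendingToOne]
  simp

/-- The rule `o_p(1) · O_p(1) = o_p(1)`. No measurability is asked of either factor. -/
theorem probOne_mul_tendsto_zero {e : ℕ × Ω → ℝ} {Z : ℕ → Ω → ℝ}
    (he : Tendsto e (probOne μ) (𝓝 0)) (hZ : IsBoundedInProb μ Z) :
    Tendsto (fun x => e x * Z x.1 x.2) (probOne μ) (𝓝 0) := by
  rw [Metric.tendsto_nhds] at he ⊢
  intro ε hε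
  rw [eventually_probOne, WithProbTendingToOne, ENNReal.tendsto_nhds_zero]
  intro ρ hρ
  obtain ⟨ρ', hρ', hρρ⟩ : ∃ ρ' : ℝ, 0 < ρ' ∧ ENNReal.ofReal ρ' + ENNReal.ofReal ρ' ≤ ρ := by
    obtain ⟨a, ha, ha'⟩ := ENNReal.lt_iff_exists_nnreal_btwn.1 hρ
    refine ⟨a / 2, by have : 0 < a := by exact_mod_cast ha
                      positivity, ?_⟩
    rw [← ENNReal.ofReal_add (by positivity) (by positivity), add_halves]
    simpa using ha'.le
  obtain ⟨C, hC⟩ := hZ ρ' hρ'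
  have h1 := he (ε / (|C| + 1)) (by positivity)
  rw [eventually_probOne, WithProbTendingToOne, ENNReal.tendsto_nhds_zero] at h1
  filter_upwards [hC, h1 (ENNReal.ofReal ρ') (by simpa using hρ')] with n hn1 hn2
  refine le_trans ?_ ((add_le_add hn1 hn2).trans hρρ)
  refine (measure_mono ?_).trans (measure_union_le _ _)
  intro ω hω
  simp only [dist_zero_right, norm_mul, Real.norm_eq_abs, not_lt, Set.mem_ofPred_eq,
    Set.mem_union] at hω ⊢
  by_contra! hcon
  have h2 : |Z n ω| < |C| + 1 := by linarith [le_abs_self C, hcon.1]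
  have h3 : |e (n, ω)| * |Z n ω| ≤ |e (n, ω)| * (|C| + 1) := by gcongr
  have h4 : |e (n, ω)| * (|C| + 1) < ε := by
    have := hcon.2
    rwa [lt_div_iff₀ (by positivity)] at this
  linarith

/-- The law of large numbers for a continuous function of iid observations, with values in a Banach
space that need not be separable. -/
theorem tendsto_average_probOne [IsProbabilityMeasure μ] {D V : Type*} [TopologicalSpace D]
    [SecondCountableTopology D]
    [MeasurableSpace D] [BorelSpace D] [TopologicalSpace.PseudoMetrizableSpace D]
    [NormedAddCommGroup V] [NormedSpace ℝ V]
    [CompleteSpace V] {Φ : D → V} (hΦ : Continuous Φ) {W : ℕ → Ω → D}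
    (hW : ∀ i, Measurable (W i)) (hindep : iIndepFun W μ)
    (hident : ∀ i, IdentDistrib (W i) (W 0) μ μ) (hint : Integrable (fun ω => Φ (W 0 ω)) μ) :
    Tendsto (fun x : ℕ × Ω => (x.1 : ℝ)⁻¹ • ∑ i : Fin x.1, Φ (W i x.2)) (probOne μ)
      (𝓝 (∫ ω, Φ (W 0 ω) ∂μ)) := by
  let _ : MeasurableSpace V := borel V
  have : BorelSpace V := ⟨rfl⟩
  -- Strong measurability is inherited from the second countable domain `D` through the continuous
  -- map `Φ`.
  have hsm : ∀ i, StronglyMeasurable fun ω => Φ (W i ω) := fun i =>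
    hΦ.comp_stronglyMeasurable (hW i).stronglyMeasurable
  have h := strong_law_ae (fun i ω => Φ (W i ω)) hint
    (fun i j hij => (hindep.indepFun hij).comp hΦ.measurable hΦ.measurable)
    (fun i => (hident i).comp hΦ.measurable)
  have h2 := tendstoInMeasure_of_tendsto_ae (μ := μ) (fun n => ?_) h
  · rw [tendstoInMeasure_iff_probOne] at h2
    refine h2.congr fun x => ?_
    rw [Finset.sum_range]
  · refine AEStronglyMeasurable.const_smul ?_ _
    exact Finset.aestronglyMeasurable_fun_sum _ fun i _ => (hsm i).aestronglyMeasurable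

end ProbOne

/-! ### Uniform limits of pairs of a map and its derivative -/

section C1Limit

variable {E : Type*} [NormedAddCommGroup E] [NormedSpace ℝ E] {S : Set E}

/-- On `S`, the pair `(f, f')` is a uniform limit of pairs of a map and its derivative. -/
def IsC1Limit (S : Set E) (f : E → E) (f' : E → E →L[ℝ] E) : Prop :=
  ∀ ε > 0, ∃ (F : E → E) (F' : E → E →L[ℝ] E), ∀ x ∈ S,
    HasFDerivAt F (F' x) x ∧ ‖F x - f x‖ ≤ ε ∧ ‖F' x - f' x‖ ≤ ε

theorem IsC1Limit.of_hasFDerivAt {f : E → E} {f' : E → E →L[ℝ] E}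
    (h : ∀ x ∈ S, HasFDerivAt f (f' x) x) : IsC1Limit S f f' :=
  fun ε hε => ⟨f, f', fun x hx => ⟨h x hx, by simpa using hε.le, by simpa using hε.le⟩⟩

theorem IsC1Limit.sub {f g : E → E} {f' g' : E → E →L[ℝ] E} (hf : IsC1Limit S f f')
    (hg : IsC1Limit S g g') : IsC1Limit S (fun x => f x - g x) fun x => f' x - g' x := by
  intro ε hε
  obtain ⟨F, F', hF⟩ := hf (ε / 2) (by positivity)
  obtain ⟨G, G', hG⟩ := hg (ε / 2) (by positivity)
  refine ⟨fun x => F x - G x, fun x => F' x - G' x, fun x hx =>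
    ⟨(hF x hx).1.sub (hG x hx).1, ?_, ?_⟩⟩
  · rw [sub_sub_sub_comm]
    exact (norm_sub_le _ _).trans (by linarith [(hF x hx).2.1, (hG x hx).2.1])
  · rw [sub_sub_sub_comm]
    exact (norm_sub_le _ _).trans (by linarith [(hF x hx).2.2, (hG x hx).2.2])

theorem IsC1Limit.clm_comp {f : E → E} {f' : E → E →L[ℝ] E} (hf : IsC1Limit S f f')
    (Q : E →L[ℝ] E) : IsC1Limit S (fun x => Q (f x)) fun x => Q.comp (f' x) := by
  intro ε hε
  obtain ⟨F, F', hF⟩ := hf (ε / (‖Q‖ + 1)) (by positivity)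
  have hQ : ‖Q‖ * (ε / (‖Q‖ + 1)) ≤ ε := by
    rw [mul_div_assoc', div_le_iff₀ (by positivity)]
    nlinarith [norm_nonneg Q]
  refine ⟨fun x => Q (F x), fun x => Q.comp (F' x), fun x hx =>
    ⟨Q.hasFDerivAt.comp x (hF x hx).1, ?_, ?_⟩⟩
  · rw [← map_sub]
    refine (Q.le_opNorm _).trans (le_trans ?_ hQ)
    gcongr
    exact (hF x hx).2.1
  · rw [← ContinuousLinearMap.comp_sub]
    refine (ContinuousLinearMap.opNorm_comp_le _ _).trans (le_trans ?_ hQ)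
    gcongr
    exact (hF x hx).2.2

/-- The mean value inequality holds for the approximating pairs with an error that tends to zero, so
it survives in the limit. All later calculus for population maps uses only this inequality, which
avoids differentiation under the integral. -/
theorem IsC1Limit.norm_sub_sub_le {f : E → E} {f' : E → E →L[ℝ] E} (hf : IsC1Limit S f f')
    {T : Set E} (hTS : T ⊆ S) (hT : Convex ℝ T)
    {c : E →L[ℝ] E} {k : ℝ} (hk : ∀ x ∈ T, ‖f' x - c‖ ≤ k) {x y : E} (hx : x ∈ T) (hy : y ∈ T) :
    ‖f x - f y - c (x - y)‖ ≤ k * ‖x - y‖ := by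
  refine le_of_forall_pos_le_add fun ε hε => ?_
  set ρ := ε / (‖x - y‖ + 2) with hρ
  have hρ0 : 0 < ρ := by positivity
  obtain ⟨F, F', hF⟩ := hf ρ hρ0
  have h1 : ‖F x - F y - c (x - y)‖ ≤ (k + ρ) * ‖x - y‖ := by
    refine hT.norm_image_sub_le_of_norm_hasFDerivWithin_le' (f' := F')
      (fun z hz => (hF z (hTS hz)).1.hasFDerivWithinAt) (fun z hz => ?_) hy hx
    rw [← sub_add_sub_cancel, add_comm k]
    exact (norm_add_le _ _).trans (add_le_add (hF z (hTS hz)).2.2 (hk z hz))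
  have h2 : f x - f y - c (x - y)
      = (F x - F y - c (x - y)) - (F x - f x) + (F y - f y) := by abel
  rw [h2]
  have h3 : ρ * (‖x - y‖ + 2) = ε := by rw [hρ]; field_simp
  refine (norm_add_le _ _).trans ?_
  have h4 := norm_sub_le (F x - F y - c (x - y)) (F x - f x)
  linarith [(hF x (hTS hx)).2.1, (hF y (hTS hy)).2.1]

end C1Limit

/-! ### Deterministic core: iterating maps that are `C¹`-close to a contraction -/

section Core

variable {K : ℕ} (L : Vec K ≃L[ℝ] Vec K) (β : Vec K) {r κ : ℝ}

theorem convex_ball (r : ℝ) : Convex ℝ (ball L β r) := by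
  have : ball L β r = (fun φ => L φ) ⁻¹' (Metric.closedBall (L β) r) := by
    ext φ; simp [ball, dist_eq_norm, map_sub]
  rw [this]
  exact (convex_closedBall _ _).linear_preimage (L : Vec K →ₗ[ℝ] Vec K)

theorem ball_eq_image (r : ℝ) : ball L β r = L.symm '' Metric.closedBall (L β) r := by
  ext φ
  constructor
  · intro h
    exact ⟨L φ, by simpa [ball, dist_eq_norm, map_sub] using h, by simp⟩
  · rintro ⟨u, hu, rfl⟩
    simpa [ball, dist_eq_norm, map_sub] using hu

theorem isCompact_ball (r : ℝ) : IsCompact (ball L β r) := by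
  rw [ball_eq_image]
  exact (isCompact_closedBall _ _).image L.symm.continuous

instance (r : ℝ) : CompactSpace (ball L β r) := isCompact_iff_compactSpace.1 (isCompact_ball L β r)

theorem mem_ball_self (hr : 0 ≤ r) : β ∈ ball L β r := by simpa [ball] using hr

theorem norm_le_symm_mul (a : Vec K) : ‖a‖ ≤ ‖(L.symm : Vec K →L[ℝ] Vec K)‖ * ‖L a‖ := by
  simpa using (L.symm : Vec K →L[ℝ] Vec K).le_opNorm (L a)

theorem norm_le_mul (a : Vec K) : ‖L a‖ ≤ ‖(L : Vec K →L[ℝ] Vec K)‖ * ‖a‖ :=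
  (L : Vec K →L[ℝ] Vec K).le_opNorm a

theorem ball_mem_nhds (hr : 0 < r) : ball L β r ∈ 𝓝 β := by
  have hc : Continuous fun φ => ‖L (φ - β)‖ := by fun_prop
  have : {φ | ‖L (φ - β)‖ < r} ∈ 𝓝 β := (isOpen_lt hc continuous_const).mem_nhds (by simpa)
  exact mem_of_superset this fun φ (hφ : ‖L (φ - β)‖ < r) => hφ.le

theorem exists_ball_subset {U : Set (Vec K)} (hU : U ∈ 𝓝 β) :
    ∃ ρ > 0, ball L β ρ ⊆ U := by
  obtain ⟨ε, hε, h⟩ := Metric.mem_nhds_iff.1 hU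
  refine ⟨ε / (2 * (‖(L.symm : Vec K →L[ℝ] Vec K)‖ + 1)), by positivity, fun φ hφ => h ?_⟩
  have h1 := norm_le_symm_mul L (φ - β)
  have h2 : ‖L (φ - β)‖ ≤ ε / (2 * (‖(L.symm : Vec K →L[ℝ] Vec K)‖ + 1)) := hφ
  rw [Metric.mem_ball, dist_eq_norm]
  set N := ‖(L.symm : Vec K →L[ℝ] Vec K)‖
  have hN : 0 ≤ N := norm_nonneg _
  calc ‖φ - β‖ ≤ N * ‖L (φ - β)‖ := h1
    _ ≤ (N + 1) * (ε / (2 * (N + 1))) := by gcongr; linarith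
    _ = ε / 2 := by field_simp
    _ < ε := by linarith

theorem ball_mono {r s : ℝ} (h : r ≤ s) : ball L β r ⊆ ball L β s := fun _ hφ => le_trans hφ h

/-- A map close to `L₀` in the sense of its linearization is a contraction in the norm `‖L ·‖`. -/
theorem norm_map_le_of_approx {κ₁ k : ℝ} {d : Vec K →L[ℝ] Vec K}
    (hd : ∀ a, ‖L (d a)‖ ≤ κ₁ * ‖L a‖) {u a : Vec K} (h : ‖u - d a‖ ≤ k * ‖a‖) (hk : 0 ≤ k) :
    ‖L u‖ ≤ (κ₁ + ‖(L : Vec K →L[ℝ] Vec K)‖ * k * ‖(L.symm : Vec K →L[ℝ] Vec K)‖) * ‖L a‖ := by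
  have h1 : L u = L (d a) + L (u - d a) := by simp
  calc ‖L u‖ ≤ ‖L (d a)‖ + ‖L (u - d a)‖ := by rw [h1]; exact norm_add_le _ _
    _ ≤ κ₁ * ‖L a‖ + ‖(L : Vec K →L[ℝ] Vec K)‖ *
          (k * (‖(L.symm : Vec K →L[ℝ] Vec K)‖ * ‖L a‖)) := by
        refine add_le_add (hd a) ((norm_le_mul L _).trans ?_)
        gcongr
        exact h.trans (by gcongr; exact norm_le_symm_mul L a)
    _ = _ := by ring

theorem exists_pos_mul_le {a b : ℝ} (ha : 0 ≤ a) (hb : 0 ≤ b) {ε : ℝ} (hε : 0 < ε) :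
    ∃ η > 0, a * η * b ≤ ε := by
  refine ⟨ε / (a * b + 1), by positivity, ?_⟩
  have : a * (ε / (a * b + 1)) * b = ε * ((a * b) / (a * b + 1)) := by ring
  rw [this]
  have h2 : a * b / (a * b + 1) ≤ 1 := by
    rw [div_le_one (by positivity)]; linarith
  nlinarith

/-- If `f₀` is differentiable on a ball around `β`, with derivative at `β` of norm at most `κ₁`, then
every map that is `C¹`-close to it contracts near `β`. -/
theorem exists_local_contraction {κ₁ q : ℝ} (hr : 0 < r) (hq : κ₁ < q)
    {f₀' : Vec K → Vec K →L[ℝ] Vec K} (hcont : ContinuousOn f₀' (ball L β r))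
    (hd : ∀ a, ‖L (f₀' β a)‖ ≤ κ₁ * ‖L a‖) :
    ∃ r₁ > 0, r₁ ≤ r ∧ ∃ η > 0, ∀ f f', IsC1Limit (ball L β r) f f' →
      (∀ x ∈ ball L β r, ‖f' x - f₀' x‖ ≤ η) → IsContractionOn L q f (ball L β r₁) := by
  -- The room `q - κ₁`, divided by the distortion of `L`, is the tolerance `η`. Half of it is spent
  -- on the oscillation of `f₀'` near `β`, half on the distance from `f'` to `f₀'`.
  obtain ⟨η, hη, hηq⟩ := exists_pos_mul_le (norm_nonneg (L : Vec K →L[ℝ] Vec K))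
    (norm_nonneg (L.symm : Vec K →L[ℝ] Vec K)) (sub_pos.2 hq)
  have hc : ∀ᶠ x in 𝓝 β, ‖f₀' x - f₀' β‖ < η / 2 := by
    have := (hcont.continuousAt (ball_mem_nhds L β hr))
    have := Metric.continuousAt_iff'.1 this (η / 2) (by positivity)
    simpa only [dist_eq_norm] using this
  obtain ⟨ρ, hρ, hρ'⟩ := exists_ball_subset L β hc
  refine ⟨min ρ r, lt_min hρ hr, min_le_right _ _, η / 2, by positivity, ?_⟩
  intro f f' hf hclose x hx y hy
  have := hf.norm_sub_sub_le
    (ball_mono L β (min_le_right ρ r)) (convex_ball L β _) (c := f₀' β) (k := η) ?_ hx hy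
  · refine (norm_map_le_of_approx L hd this hη.le).trans ?_
    gcongr
    linarith
  · intro z hz
    have h1 : ‖f₀' z - f₀' β‖ < η / 2 := hρ' (ball_mono L β (min_le_left ρ r) hz)
    have h2 := hclose z (ball_mono L β (min_le_right ρ r) hz)
    rw [← sub_add_sub_cancel (f' z) (f₀' z)]
    exact (norm_add_le _ _).trans (by linarith)

/-- Conjugation by `L` turns the ball into a complete Euclidean ball, where Banach's theorem
applies. -/
theorem exists_fixedPoint_of_contraction {κ' : ℝ} (hr : 0 < r) (h0 : 0 ≤ κ') (h1 : κ' < 1)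
    {f : Vec K → Vec K} (hmaps : ∀ x ∈ ball L β r, f x ∈ ball L β r)
    (hf : IsContractionOn L κ' f (ball L β r)) : ∃ b ∈ ball L β r, f b = b := by
  lift κ' to NNReal using h0
  have hsf : Set.MapsTo (fun u => L (f (L.symm u))) (Metric.closedBall (L β) r)
      (Metric.closedBall (L β) r) := by
    intro u hu
    have := hmaps (L.symm u) (by rw [ball_eq_image]; exact ⟨u, hu, rfl⟩)
    simpa [ball, dist_eq_norm, map_sub] using this
  have hcw : ContractingWith κ' (hsf.restrict _ _ _) := by
    refine ⟨by exact_mod_cast h1, LipschitzWith.of_dist_le_mul fun u v => ?_⟩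
    have hu : L.symm u ∈ ball L β r := by rw [ball_eq_image]; exact ⟨u, u.2, rfl⟩
    have hv : L.symm v ∈ ball L β r := by rw [ball_eq_image]; exact ⟨v, v.2, rfl⟩
    have := hf _ hu _ hv
    simpa [Subtype.dist_eq, dist_eq_norm, map_sub] using this
  obtain ⟨y, hy, hfix, -⟩ := hcw.exists_fixedPoint' Metric.isClosed_closedBall.isComplete hsf
    (Metric.mem_closedBall_self hr.le) (edist_ne_top _ _)
  refine ⟨L.symm y, by rw [ball_eq_image]; exact ⟨y, hy, rfl⟩, ?_⟩
  have : L (f (L.symm y)) = y := hfix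
  exact L.injective (by simpa using this)

/-- Fixed point iteration for all maps `C¹`-close to a contraction `f₀`: the asymptotic rate is
governed by the derivative at the fixed point. -/
theorem exists_uniform_rate {κ₁ : ℝ} (hr : 0 < r) (hκ₁ : 0 ≤ κ₁) (hκ : κ₁ < κ) (hκ1 : κ < 1)
    {f₀ : Vec K → Vec K} {f₀' : Vec K → Vec K →L[ℝ] Vec K} (hf₀ : IsC1Limit (ball L β r) f₀ f₀')
    (hcont : ContinuousOn f₀' (ball L β r)) (hfix : f₀ β = β)
    (hcontr : IsContractionOn L κ f₀ (ball L β r))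
    (hd : ∀ a, ‖L (f₀' β a)‖ ≤ κ₁ * ‖L a‖) :
    ∃ q C η : ℝ, 0 < q ∧ q < κ ∧ 0 ≤ C ∧ 0 < η ∧ ∀ f f', IsC1Limit (ball L β r) f f' →
      (∀ x ∈ ball L β r, ‖f x - f₀ x‖ ≤ η) → (∀ x ∈ ball L β r, ‖f' x - f₀' x‖ ≤ η) →
      ∃ b ∈ ball L β r, f b = b ∧ ‖b - β‖ ≤ C * ‖f β - β‖ ∧
        ∀ b₀ ∈ ball L β r, ∀ t : ℕ, ‖f^[t] b₀ - b‖ ≤ C * q ^ t := by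
  set N := ‖(L : Vec K →L[ℝ] Vec K)‖
  set N' := ‖(L.symm : Vec K →L[ℝ] Vec K)‖
  have hN : 0 ≤ N := norm_nonneg _
  have hN' : 0 ≤ N' := norm_nonneg _
  -- Two rates are used: `q < κ` on a small ball around `β`, governed by the derivative at `β`, and
  -- below `κ' > κ` on the whole ball, where closeness costs a little of the contraction.
  set q := (κ₁ + κ) / 2 with hq
  have hq0 : 0 < q := by rw [hq]; linarith
  have hqκ : q < κ := by rw [hq]; linarith
  set κ' := (κ + 1) / 2 with hκ'
  have hκ'0 : 0 < κ' := by rw [hκ']; linarith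
  have hκ'1 : κ' < 1 := by rw [hκ']; linarith
  obtain ⟨r₁, hr₁, hr₁r, η₄, hη₄, hloc⟩ := exists_local_contraction L β hr (κ₁ := κ₁) (q := q)
    (by rw [hq]; linarith) hcont hd
  -- Two points of the ball are at most `2r` apart; `T` steps at rate `κ'` bring any start within
  -- `r₁ / 2` of the fixed point, after which the local rate takes over.
  obtain ⟨T, hT⟩ : ∃ T : ℕ, κ' ^ T * (2 * r) ≤ r₁ / 2 := by
    have h := (tendsto_pow_atTop_nhds_zero_of_lt_one hκ'0.le hκ'1).mul_const (2 * r)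
    rw [zero_mul] at h
    exact ((h.eventually (gt_mem_nhds (by positivity : 0 < r₁ / 2))).exists).imp fun _ h => h.le
  -- The four tolerances: `η` gives modulus `κ'` on the ball, `η₂` keeps the ball invariant, `η₃`
  -- puts the fixed point within `r₁ / 2` of `β`, and `η₄` gives modulus `q` on the small ball.
  obtain ⟨η, hη, h1η⟩ := exists_pos_mul_le hN hN' (by linarith : 0 < κ' - κ)
  obtain ⟨η₂, hη₂, h2η⟩ := exists_pos_mul_le hN zero_le_one
    (by nlinarith : 0 < (1 - κ) * r)
  obtain ⟨η₃, hη₃, h3η⟩ := exists_pos_mul_le hN (inv_nonneg.2 (by linarith : 0 ≤ 1 - κ'))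
    (by positivity : 0 < r₁ / 2)
  -- The first summand bounds the distance of the fixed point from `β`; the second bounds the
  -- iterates, with `(q ^ T)⁻¹` paying for the first `T` slower steps.
  set C := N' * (1 - κ')⁻¹ * N + N' * (2 * r) * (q ^ T)⁻¹ with hC
  have h1κ' : 0 < 1 - κ' := by linarith
  have hC1 : 0 ≤ N' * (1 - κ')⁻¹ * N := by positivity
  have hC2 : 0 ≤ N' * (2 * r) * (q ^ T)⁻¹ := by positivity
  refine ⟨q, C, min (min η η₂) (min η₃ η₄), hq0, hqκ, by rw [hC]; positivity,
    lt_min (lt_min hη hη₂) (lt_min hη₃ hη₄), ?_⟩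
  intro f f' hf hclose hclose'
  replace hloc := hloc f f' hf fun x hx => (hclose' x hx).trans
    ((min_le_right _ _).trans (min_le_right _ _))
  have hcon : IsContractionOn L κ' f (ball L β r) := by
    intro x hx y hy
    -- The difference `f - f₀` has derivative at most `η`, hence is `η`-Lipschitz and adds little to
    -- the modulus of `f₀`.
    have h := (hf.sub hf₀).norm_sub_sub_le subset_rfl (convex_ball L β r) (c := 0) (k := η)
      (fun z hz => by
        rw [sub_zero]
        exact (hclose' z hz).trans ((min_le_left _ _).trans (min_le_left _ _))) hx hy
    simp only [zero_apply, sub_zero] at h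
    set u := f x - f₀ x - (f y - f₀ y) with hu
    have hsplit : f x - f y = u + (f₀ x - f₀ y) := by rw [hu]; abel
    rw [hsplit, map_add]
    calc ‖L u + L (f₀ x - f₀ y)‖
        ≤ N * (η * (N' * ‖L (x - y)‖)) + κ * ‖L (x - y)‖ := by
          refine (norm_add_le _ _).trans
            (add_le_add ((norm_le_mul L u).trans ?_) (hcontr _ hx _ hy))
          gcongr
          exact h.trans (by gcongr; exact norm_le_symm_mul L _)
      _ = (N * η * N' + κ) * ‖L (x - y)‖ := by ring
      _ ≤ κ' * ‖L (x - y)‖ := by gcongr; linarith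
  have hβ := mem_ball_self L β hr.le
  have hmaps : ∀ x ∈ ball L β r, f x ∈ ball L β r := by
    intro x hx
    have h1 := hcontr x hx β hβ
    rw [hfix] at h1
    have hx' : ‖L (x - β)‖ ≤ r := hx
    change ‖L (f x - β)‖ ≤ r
    have : f x - β = (f x - f₀ x) + (f₀ x - β) := by abel
    rw [this, map_add]
    calc _ ≤ N * η₂ + κ * r := by
          refine (norm_add_le _ _).trans (add_le_add ((norm_le_mul L _).trans ?_) (h1.trans ?_))
          · gcongr
            exact (hclose x hx).trans ((min_le_left _ _).trans (min_le_right _ _))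
          · gcongr; linarith
      _ ≤ r := by nlinarith
  obtain ⟨b, hb, hfb⟩ := exists_fixedPoint_of_contraction L β hr hκ'0.le hκ'1 hmaps hcon
  have hbβ : ‖L (b - β)‖ ≤ (1 - κ')⁻¹ * (N * ‖f β - β‖) := by
    have h1 := hcon b hb β hβ
    rw [hfb] at h1
    have h2 : b - β = (b - f β) + (f β - β) := by abel
    have h3 : ‖L (b - β)‖ ≤ ‖L (b - f β)‖ + ‖L (f β - β)‖ := by
      conv_lhs => rw [h2, map_add]
      exact norm_add_le _ _
    have h4 := norm_le_mul L (f β - β)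
    rw [inv_mul_eq_div, le_div_iff₀ h1κ']
    nlinarith
  have hbβ' : ‖L (b - β)‖ ≤ r₁ / 2 := by
    refine hbβ.trans (le_trans ?_ h3η)
    have : ‖f β - β‖ ≤ η₃ := by
      have h := (hclose β hβ).trans ((min_le_right _ _).trans (min_le_left _ _))
      rwa [hfix] at h
    calc (1 - κ')⁻¹ * (N * ‖f β - β‖) ≤ (1 - κ')⁻¹ * (N * η₃) := by gcongr
      _ = N * η₃ * (1 - κ')⁻¹ := by ring
  refine ⟨b, hb, hfb, ?_, ?_⟩
  · calc ‖b - β‖ ≤ N' * ((1 - κ')⁻¹ * (N * ‖f β - β‖)) :=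
          (norm_le_symm_mul L _).trans (by gcongr)
      _ = (N' * (1 - κ')⁻¹ * N) * ‖f β - β‖ := by ring
      _ ≤ C * ‖f β - β‖ := by gcongr; rw [hC]; linarith
  · intro b₀ hb₀ t
    have hin : ∀ t, f^[t] b₀ ∈ ball L β r := by
      intro t
      induction t with
      | zero => exact hb₀
      | succ t ih => rw [Function.iterate_succ_apply']; exact hmaps _ ih
    have hglob : ∀ t, ‖L (f^[t] b₀ - b)‖ ≤ κ' ^ t * (2 * r) := by
      intro t
      induction t with
      | zero =>
        have h1 : ‖L (b₀ - β)‖ ≤ r := hb₀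
        have h2 : b₀ - b = (b₀ - β) - (b - β) := by abel
        rw [Function.iterate_zero_apply, h2, map_sub, pow_zero, one_mul]
        refine (norm_sub_le _ _).trans ?_
        linarith
      | succ t ih =>
        have h := hcon _ (hin t) _ hb
        rw [hfb, ← Function.iterate_succ_apply' f t b₀] at h
        refine h.trans ?_
        rw [pow_succ', mul_assoc]
        gcongr
    -- After time `T` the iterates stay within `r₁ / 2` of `b`, and `b` is within `r₁ / 2` of `β`,
    -- so both lie in the ball where `f` contracts at rate `q`.
    have hlocal : ∀ s, ‖L (f^[T + s] b₀ - b)‖ ≤ q ^ s * (r₁ / 2) := by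
      intro s
      induction s with
      | zero => simpa using (hglob T).trans hT
      | succ s ih =>
        have hq1 : q ^ s ≤ 1 := pow_le_one₀ hq0.le (by linarith)
        have hmem1 : f^[T + s] b₀ ∈ ball L β r₁ := by
          have h2 : f^[T + s] b₀ - β = (f^[T + s] b₀ - b) + (b - β) := by abel
          change ‖L (f^[T + s] b₀ - β)‖ ≤ r₁
          rw [h2, map_add]
          refine (norm_add_le _ _).trans ?_
          nlinarith
        have h := hloc _ hmem1 b (le_trans hbβ' (by linarith))
        rw [hfb, ← Function.iterate_succ_apply' f (T + s) b₀] at h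
        refine h.trans ?_
        rw [pow_succ', mul_assoc]
        gcongr
    have hmain : ‖L (f^[t] b₀ - b)‖ ≤ 2 * r * (q ^ T)⁻¹ * q ^ t := by
      rcases le_total T t with h | h
      · obtain ⟨s, rfl⟩ := Nat.exists_eq_add_of_le h
        refine (hlocal s).trans ?_
        rw [pow_add]
        have : 2 * r * (q ^ T)⁻¹ * (q ^ T * q ^ s) = q ^ s * (2 * r) := by
          field_simp
        rw [this]
        gcongr
        linarith
      · have h1 : κ' ^ t ≤ 1 := pow_le_one₀ hκ'0.le hκ'1.le
        have h2 : 1 ≤ (q ^ T)⁻¹ * q ^ t := by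
          rw [inv_mul_eq_div, one_le_div (by positivity)]
          exact pow_le_pow_of_le_one hq0.le (by linarith) h
        refine (hglob t).trans ?_
        rw [mul_assoc]
        nlinarith
    calc ‖f^[t] b₀ - b‖ ≤ N' * (2 * r * (q ^ T)⁻¹ * q ^ t) :=
          (norm_le_symm_mul L _).trans (by gcongr)
      _ = (N' * (2 * r) * (q ^ T)⁻¹) * q ^ t := by ring
      _ ≤ C * q ^ t := by gcongr; rw [hC]; linarith

end Core

/-! ### Multivariate central limit theorem and tightness -/

section CLT

variable {Ω : Type*} [MeasurableSpace Ω] {μ : Measure Ω} [IsProbabilityMeasure μ] {K : ℕ}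

/-- The multivariate central limit theorem, for centred iid vectors. -/
theorem tendstoInDistribution_multivariate {ψ : ℕ → Ω → Vec K} {V : Matrix (Fin K) (Fin K) ℝ}
    (hV : V.PosSemidef) (hL2 : MemLp (ψ 0) 2 μ) (hmean : ∫ ω, ψ 0 ω ∂μ = 0)
    (hvar : ∀ a : Vec K, Var[fun ω => inner ℝ a (ψ 0 ω); μ] = a.ofLp ⬝ᵥ V.mulVec a.ofLp)
    (hindep : iIndepFun ψ μ) (hident : ∀ i, IdentDistrib (ψ i) (ψ 0) μ μ) :
    TendstoInDistribution (fun (n : ℕ) ω => (√(n : ℝ))⁻¹ • ∑ i : Fin n, ψ i ω) atTop id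
      (fun _ => μ) (multivariateGaussian 0 V) where
  forall_aemeasurable n := (Finset.aemeasurable_fun_sum Finset.univ
    fun (i : Fin n) _ => (hident i).aemeasurable_fst).const_smul (√(n : ℝ))⁻¹
  aemeasurable_limit := aemeasurable_id
  tendsto := by
    refine ProbabilityMeasure.tendsto_iff_tendsto_charFun.2 fun a => ?_
    have hL2a : MemLp (fun ω => inner ℝ a (ψ 0 ω)) 2 μ := hL2.const_inner a
    have hclt := tendstoInDistribution_inv_sqrt_mul_sum_sub (P := μ)
      (P' := gaussianReal 0 (Var[fun ω => inner ℝ a (ψ 0 ω); μ]).toNNReal)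
      (X := fun i ω => inner ℝ a (ψ i ω)) (Y := id) HasLaw.id hL2a
      (hindep.comp (fun _ x => inner ℝ a x) fun _ => by fun_prop)
      (fun i => (hident i).comp (u := fun x => inner ℝ a x) (by fun_prop))
    have hmean' : ∫ ω, inner ℝ a (ψ 0 ω) ∂μ = 0 := by
      rw [integral_inner (hL2.integrable (by norm_num)), hmean, inner_zero_right]
    -- Cramér–Wold: the characteristic function of the vector at `a` is that of its projection on
    -- `a` at `1`.
    have h1 := ProbabilityMeasure.tendsto_iff_tendsto_charFun.1 hclt.tendsto 1
    simp only [ProbabilityMeasure.coe_mk, Measure.map_id] at h1 ⊢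
    rw [charFun_multivariateGaussian hV]
    rw [charFun_gaussianReal] at h1
    have hnn : 0 ≤ Var[fun ω => inner ℝ a (ψ 0 ω); μ] := variance_nonneg _ _
    convert h1 using 2 with n
    · rw [charFun_apply, charFun_apply, integral_map, integral_map]
      · congr 1 with ω
        simp only [hmean', mul_zero, sub_zero, inner_smul_left, sum_inner]
        simp [real_inner_comm, Finset.sum_range]
      · exact hclt.forall_aemeasurable n
      · exact Continuous.aestronglyMeasurable (by fun_prop)
      · exact (Finset.aemeasurable_fun_sum Finset.univ
          fun (i : Fin n) _ => (hident i).aemeasurable_fst).const_smul (√(n : ℝ))⁻¹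
      · exact Continuous.aestronglyMeasurable (by fun_prop)
    · rw [← hvar, Real.coe_toNNReal _ hnn]
      simp

/-- Pointwise convergence of characteristic functions to a limit continuous at zero makes the laws
tight, and tightness is boundedness in probability. -/
theorem isBoundedInProb_of_tendstoInDistribution {Z : ℕ → Ω → Vec K} {ν : Measure (Vec K)}
    [IsProbabilityMeasure ν]
    (h : TendstoInDistribution Z atTop id (fun _ => μ) ν) :
    IsBoundedInProb μ fun n ω => ‖Z n ω‖ := by
  have h1 := ProbabilityMeasure.tendsto_iff_tendsto_charFun.1 h.tendsto
  have hi : ∀ n, IsProbabilityMeasure (μ.map (Z n)) := fun n =>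
    Measure.isProbabilityMeasure_map (h.forall_aemeasurable n)
  have ht := isTightMeasureSet_of_tendsto_charFun (f := charFun ν)
    (μ := fun n => μ.map (Z n)) (continuous_charFun.continuousAt) (by simpa using h1)
  have h2 := tendsto_measure_norm_gt_of_isTightMeasureSet ht
  intro ε hε
  have h3 := (ENNReal.tendsto_nhds_zero.1 h2) (ENNReal.ofReal ε) (by simpa using hε)
  obtain ⟨C, hC⟩ := h3.exists
  refine ⟨C, Eventually.of_forall fun n => ?_⟩
  have h4 : (μ.map (Z n)) {x | C < ‖x‖} ≤ ENNReal.ofReal ε :=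
    (le_iSup₂ (f := fun (ρ : Measure (Vec K)) (_ : ρ ∈ Set.range fun n => μ.map (Z n)) =>
      ρ {x | C < ‖x‖}) _ ⟨n, rfl⟩).trans hC
  rw [Measure.map_apply_of_aemeasurable (h.forall_aemeasurable n)
    (measurableSet_lt measurable_const measurable_norm)] at h4
  simpa using h4

end CLT

open InnerProductSpace (rankOne)

/-! ### One observation: error, weight, gradient -/

section Observation

variable {K : ℕ} (v : Form) (δ : ℝ)

/-- Factoring out `exp z` gives `log (y + δ exp z) = z + log (δ + y exp (-z))`, and the correction
removes exactly the last logarithm. Both forms of the model thus reduce to their error. -/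
theorem transformed_eq {v : Form} {δ y z : ℝ} (hδ : 0 < δ) (hy : 0 ≤ y) :
    transformed v δ y z = z + err v y z / (1 + δ) := by
  have h1 : y + δ * Real.exp z = Real.exp z * (δ + y * Real.exp (-z)) := by
    rw [mul_add, mul_comm y, ← mul_assoc (Real.exp z), ← Real.exp_add]
    simp; ring
  have h2 : 0 < δ + y * Real.exp (-z) := by positivity
  rw [transformed, correction, h1, Real.log_mul (Real.exp_pos z).ne' h2.ne', Real.log_exp]
  ring

theorem one_sub_weight_nonneg {v : Form} {δ y z : ℝ} (hδ : 0 < δ) (hy : 0 ≤ y) :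
    0 ≤ 1 - weight v δ y z := by
  cases v <;> simp only [weight, sub_sub_cancel] <;> positivity

theorem hasDerivAt_err (hδ : 0 < δ) (y z : ℝ) :
    HasDerivAt (err v y) (-((1 + δ) * (1 - weight v δ y z))) z := by
  have h : (1 + δ) ≠ 0 := by positivity
  cases v
  · have : HasDerivAt (err .MP y) _ z :=
      ((((hasDerivAt_id z).fun_neg).exp).const_mul y).sub_const 1
    refine this.congr_deriv ?_
    simp only [weight, id]
    field_simp
    ring_nf
  · have : HasDerivAt (err .AP y) _ z := (Real.hasDerivAt_exp z).const_sub y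
    refine this.congr_deriv ?_
    simp only [weight]
    field_simp
    ring_nf

/-- The step subtracted from `φ` by one observation in the iteration, up to the factor `(X'X)⁻¹`. -/
noncomputable def grad (x : Vec K) (y : ℝ) (φ : Vec K) : Vec K := -((err v y (inner ℝ x φ) / (1 + δ)) • x)

/-- The derivative of `grad`. -/
noncomputable def gradDeriv (x : Vec K) (y : ℝ) (φ : Vec K) : Vec K →L[ℝ] Vec K :=
  (1 - weight v δ y (inner ℝ x φ)) • rankOne ℝ x x

variable {v δ}

theorem gradDeriv_apply (x : Vec K) (y : ℝ) (φ a : Vec K) :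
    gradDeriv v δ x y φ a = ((1 - weight v δ y (inner ℝ x φ)) * inner ℝ x a) • x := by
  simp [gradDeriv, smul_smul]

theorem hasFDerivAt_grad (hδ : 0 < δ) (x : Vec K) (y : ℝ) (φ : Vec K) :
    HasFDerivAt (grad v δ x y) (gradDeriv v δ x y φ) φ := by
  have h1 : HasFDerivAt (fun φ : Vec K => (inner ℝ x φ : ℝ)) (innerSL ℝ x) φ :=
    (innerSL ℝ x).hasFDerivAt
  have h2 := (((hasDerivAt_err v δ hδ y (inner ℝ x φ)).comp_hasFDerivAt φ h1).mul_const
    ((1 + δ)⁻¹)).smul_const x |>.neg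
  refine (h2.congr_fderiv ?_).congr_of_eventuallyEq (Eventually.of_forall fun φ => ?_)
  · ext1 a
    rw [gradDeriv_apply]
    have h : (1 + δ) ≠ 0 := by positivity
    simp [smul_smul]
    congr 1
    field_simp
  · simp [grad, div_eq_mul_inv]

theorem err_strictAntitone {y z z' : ℝ} (hy : 0 ≤ y) :
    (z - z') * (err v y z - err v y z') ≤ 0 := by
  cases v <;> simp only [err]
  · rcases le_total z z' with h | h
    · have : Real.exp (-z') ≤ Real.exp (-z) := Real.exp_le_exp.2 (by linarith)
      nlinarith [mul_le_mul_of_nonneg_left this hy]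
    · have : Real.exp (-z) ≤ Real.exp (-z') := Real.exp_le_exp.2 (by linarith)
      nlinarith [mul_le_mul_of_nonneg_left this hy]
  · rcases le_total z z' with h | h
    · have : Real.exp z ≤ Real.exp z' := Real.exp_le_exp.2 h
      nlinarith
    · have : Real.exp z' ≤ Real.exp z := Real.exp_le_exp.2 h
      nlinarith

/-- Equality in the monotonicity of the error means equal indices, except for `MP` with `y = 0`;
there the error is constant, but `1 - weight` vanishes at every index `w`. -/
theorem weight_eq_one_or_eq_of_err {y z z' w : ℝ} (h : (z - z') * (err v y z - err v y z') = 0) :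
    (1 - weight v δ y w) * (z - z') = 0 := by
  rcases mul_eq_zero.1 h with h | h
  · rw [h, mul_zero]
  · cases v <;> simp only [err, weight, sub_sub_cancel] at h ⊢
    · have h1 : y * (Real.exp (-z) - Real.exp (-z')) = 0 := by linarith
      rcases mul_eq_zero.1 h1 with h2 | h2
      · simp [h2]
      · have : z = z' := by linarith [Real.exp_injective (sub_eq_zero.1 h2)]
        simp [this]
    · have : z = z' := Real.exp_injective (by linarith)
      simp [this]

end Observation

/-! ### The sample map, its fixed points, and uniqueness of the Poisson estimate -/

section Sample

variable {K n : ℕ} {v : Form} {δ : ℝ}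

theorem inner_single_one (x : Vec K) (k : Fin K) :
    inner ℝ x (EuclideanSpace.single k 1) = x k := by
  simp [EuclideanSpace.inner_single_right]

theorem inverse_apply_apply {T : Vec K →L[ℝ] Vec K} (hT : IsUnit T) (a : Vec K) :
    Ring.inverse T (T a) = a := by
  change (Ring.inverse T * T) a = a
  rw [Ring.inverse_mul_cancel _ hT]
  rfl

theorem apply_inverse_apply {T : Vec K →L[ℝ] Vec K} (hT : IsUnit T) (a : Vec K) :
    T (Ring.inverse T a) = a := by
  change (T * Ring.inverse T) a = a
  rw [Ring.mul_inverse_cancel _ hT]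
  rfl

theorem toEuclideanCLM_eq_iff {A : Matrix (Fin K) (Fin K) ℝ} {T : Vec K →L[ℝ] Vec K} :
    Matrix.toEuclideanCLM (𝕜 := ℝ) A = T ↔
      ∀ k l, A k l = T (EuclideanSpace.single l 1) k := by
  constructor
  · rintro rfl k l
    simp [Matrix.mulVec_single]
  · intro h
    refine ContinuousLinearMap.coe_injective
      ((EuclideanSpace.basisFun (Fin K) ℝ).toBasis.ext fun l => ?_)
    ext k
    simp [← h, Matrix.mulVec_single]

theorem toEuclideanCLM_inv {A : Matrix (Fin K) (Fin K) ℝ} (hA : IsUnit A) :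
    Matrix.toEuclideanCLM (𝕜 := ℝ) A⁻¹ = Ring.inverse (Matrix.toEuclideanCLM (𝕜 := ℝ) A) := by
  have hdet := (Matrix.isUnit_iff_isUnit_det A).1 hA
  have h1 : Matrix.toEuclideanCLM (𝕜 := ℝ) A⁻¹ * Matrix.toEuclideanCLM (𝕜 := ℝ) A = 1 := by
    rw [← map_mul, Matrix.nonsing_inv_mul _ hdet, map_one]
  have h2 : IsUnit (Matrix.toEuclideanCLM (𝕜 := ℝ) A) := hA.map _
  calc _ = Matrix.toEuclideanCLM (𝕜 := ℝ) A⁻¹ * (Matrix.toEuclideanCLM (𝕜 := ℝ) A *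
        Ring.inverse (Matrix.toEuclideanCLM (𝕜 := ℝ) A)) := by
        rw [Ring.mul_inverse_cancel _ h2, mul_one]
    _ = _ := by rw [← mul_assoc, h1, one_mul]

theorem isUnit_toEuclideanCLM_iff {A : Matrix (Fin K) (Fin K) ℝ} :
    IsUnit (Matrix.toEuclideanCLM (𝕜 := ℝ) A) ↔ IsUnit A :=
  MulEquiv.isUnit_map (Matrix.toEuclideanCLM (n := Fin K) (𝕜 := ℝ))

theorem isUnit_of_rank_eq {A : Matrix (Fin K) (Fin K) ℝ} (h : A.rank = K) : IsUnit A := by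
  rw [← Matrix.mulVec_surjective_iff_isUnit]
  have : LinearMap.range A.mulVecLin = ⊤ := by
    apply Submodule.eq_top_of_finrank_eq
    rw [← Matrix.rank, h]
    simp
  exact LinearMap.range_eq_top.1 this

theorem isUnit_gram_iff (x : Fin n → Vec K) :
    IsUnit ((design x).transpose * design x) ↔ (design x).rank = K := by
  constructor
  · intro h
    rw [← Matrix.rank_transpose_mul_self, Matrix.rank_of_isUnit _ h, Fintype.card_fin]
  · intro h
    exact isUnit_of_rank_eq (by rw [Matrix.rank_transpose_mul_self, h])

theorem toEuclideanCLM_gram (x : Fin n → Vec K) :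
    Matrix.toEuclideanCLM (𝕜 := ℝ) ((design x).transpose * design x) =
      ∑ i, rankOne ℝ (x i) (x i) := by
  rw [toEuclideanCLM_eq_iff]
  intro k l
  simp [Matrix.mul_apply, design, mul_comm, inner_single_one]

theorem toEuclideanCLM_bread (x : Fin n → Vec K) (y : Fin n → ℝ) (φ : Vec K) :
    Matrix.toEuclideanCLM (𝕜 := ℝ) (bread v δ x y φ) =
      (n : ℝ)⁻¹ • ∑ i, gradDeriv v δ (x i) (y i) φ := by
  rw [toEuclideanCLM_eq_iff]
  intro k l
  simp only [bread, Matrix.smul_apply, smul_eq_mul, smul_apply,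
    sum_apply, gradDeriv_apply, PiLp.smul_apply]
  congr 1
  rw [show (1 : Matrix (Fin n) (Fin n) ℝ) = Matrix.diagonal 1 from Matrix.diagonal_one.symm,
    Matrix.diagonal_sub, Matrix.mul_apply]
  simp [Matrix.mul_diagonal, design, inner_single_one]
  refine Finset.sum_congr rfl fun i _ => by ring

theorem step_eq (hδ : 0 < δ) (x : Fin n → Vec K) (y : Fin n → ℝ) (hy : ∀ i, 0 ≤ y i)
    (hx : IsUnit ((design x).transpose * design x)) (φ : Vec K) :
    step v δ x y φ = φ - Ring.inverse (∑ i, rankOne ℝ (x i) (x i))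
      (∑ i, grad v δ (x i) (y i) φ) := by
  have hU : IsUnit (∑ i, rankOne ℝ (x i) (x i)) := by
    rw [← toEuclideanCLM_gram, isUnit_toEuclideanCLM_iff]; exact hx
  have h1 : WithLp.toLp 2 ((design x).transpose.mulVec
      fun i => transformed v δ (y i) (inner ℝ (x i) φ)) =
      (∑ i, rankOne ℝ (x i) (x i)) φ - ∑ i, grad v δ (x i) (y i) φ := by
    rw [sum_apply, ← Finset.sum_sub_distrib]
    ext k
    simp only [Matrix.mulVec, dotProduct, WithLp.ofLp_sum, Finset.sum_apply]
    refine Finset.sum_congr rfl fun i _ => ?_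
    rw [transformed_eq hδ (hy i)]
    simp [design, grad]
    ring
  have h2 : step v δ x y φ = Matrix.toEuclideanCLM (𝕜 := ℝ)
      (((design x).transpose * design x)⁻¹) (WithLp.toLp 2 ((design x).transpose.mulVec
      fun i => transformed v δ (y i) (inner ℝ (x i) φ))) := rfl
  rw [h2, h1, toEuclideanCLM_inv hx, toEuclideanCLM_gram, map_sub,
    inverse_apply_apply hU]

theorem step_eq_self_iff (hδ : 0 < δ) (x : Fin n → Vec K) (y : Fin n → ℝ) (hy : ∀ i, 0 ≤ y i)
    (hx : IsUnit ((design x).transpose * design x)) (b : Vec K) :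
    step v δ x y b = b ↔ ∑ i, grad v δ (x i) (y i) b = 0 := by
  have hU : IsUnit (∑ i, rankOne ℝ (x i) (x i)) := by
    rw [← toEuclideanCLM_gram, isUnit_toEuclideanCLM_iff]; exact hx
  rw [step_eq hδ x y hy hx, sub_eq_self]
  constructor
  · intro h
    rw [← apply_inverse_apply hU (∑ i, grad v δ (x i) (y i) b), h, map_zero]
  · intro h
    rw [h, map_zero]

theorem sum_grad_eq_zero_iff (hδ : 0 < δ) (x : Fin n → Vec K) (y : Fin n → ℝ) (b : Vec K) :
    ∑ i, grad v δ (x i) (y i) b = 0 ↔ ∑ i, err v (y i) (inner ℝ (x i) b) • x i = 0 := by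
  have h : (1 + δ) ≠ 0 := by positivity
  have : ∑ i, grad v δ (x i) (y i) b =
      (-(1 + δ)⁻¹) • ∑ i, err v (y i) (inner ℝ (x i) b) • x i := by
    rw [Finset.smul_sum]
    refine Finset.sum_congr rfl fun i _ => ?_
    rw [grad, smul_smul, ← neg_smul]
    congr 1
    ring
  rw [this, smul_eq_zero, or_iff_right]
  simp [h]

/-- Necessity is the first-order condition along lines. Sufficiency is concavity, via the tangent
inequality `1 + s ≤ exp s` in each summand. -/
theorem isMaxOn_pseudoLogLik_iff (x : Fin n → Vec K) (y : Fin n → ℝ) (b : Vec K) :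
    IsMaxOn (pseudoLogLik x y) Set.univ b ↔ ∑ i, err .AP (y i) (inner ℝ (x i) b) • x i = 0 := by
  constructor
  · intro h
    refine ext_inner_right ℝ fun a => ?_
    rw [inner_zero_left, sum_inner]
    have hd : HasDerivAt (fun s : ℝ => pseudoLogLik x y (b + s • a))
        (∑ i, (y i * inner ℝ (x i) a -
          Real.exp (inner ℝ (x i) (b + (0 : ℝ) • a)) * inner ℝ (x i) a)) 0 := by
      unfold pseudoLogLik
      refine HasDerivAt.fun_sum fun i _ => ?_
      have h1 : HasDerivAt (fun s : ℝ => (inner ℝ (x i) (b + s • a) : ℝ)) (inner ℝ (x i) a) 0 := by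
        simp only [inner_add_right, inner_smul_right]
        simpa using ((hasDerivAt_id (0 : ℝ)).mul_const (inner ℝ (x i) a)).const_add
          (inner ℝ (x i) b)
      exact (h1.const_mul (y i)).sub h1.exp
    have hmax : IsLocalMax (fun s : ℝ => pseudoLogLik x y (b + s • a)) 0 := by
      refine Eventually.of_forall fun s => ?_
      simpa using h (Set.mem_univ (b + s • a))
    have := hmax.hasDerivAt_eq_zero hd
    rw [← this]
    refine Finset.sum_congr rfl fun i _ => ?_
    simp [err, inner_smul_left]
    ring
  · intro h a _
    have h0 : ∑ i, err .AP (y i) (inner ℝ (x i) b) * inner ℝ (x i) (a - b) = 0 := by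
      have := congrArg (fun u => (inner ℝ u (a - b) : ℝ)) h
      simpa [sum_inner, inner_smul_left] using this
    change pseudoLogLik x y a ≤ pseudoLogLik x y b
    rw [← sub_nonpos, ← h0, pseudoLogLik, pseudoLogLik, ← Finset.sum_sub_distrib]
    refine Finset.sum_le_sum fun i _ => ?_
    rw [inner_sub_right, err]
    set z := inner ℝ (x i) b
    set z' := inner ℝ (x i) a
    have h1 : Real.exp z' = Real.exp z * Real.exp (z' - z) := by rw [← Real.exp_add]; ring_nf
    have h2 := Real.add_one_le_exp (z' - z)
    nlinarith [Real.exp_pos z]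

theorem sum_grad_eq_zero_iff_isPoissonEstimate (hδ : 0 < δ) (x : Fin n → Vec K) (y : Fin n → ℝ)
    (b : Vec K) :
    ∑ i, grad v δ (x i) (y i) b = 0 ↔ IsPoissonEstimate v x y b := by
  rw [sum_grad_eq_zero_iff hδ]
  cases v
  · rfl
  · exact (isMaxOn_pseudoLogLik_iff x y b).symm

theorem continuous_grad (v : Form) (δ : ℝ) {α : Type*} [TopologicalSpace α] {x φ : α → Vec K}
    {y : α → ℝ} (hx : Continuous x) (hy : Continuous y) (hφ : Continuous φ) :
    Continuous fun a => grad v δ (x a) (y a) (φ a) := by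
  have h : Continuous fun a => err v (y a) (inner ℝ (x a) (φ a)) := by
    cases v <;> simp only [err] <;> fun_prop
  unfold grad
  fun_prop

theorem fixedPoint_iff_and_limit (hδ : 0 < δ) (x : Fin n → Vec K) (y : Fin n → ℝ)
    (hy : ∀ i, 0 ≤ y i) (hx : (design x).rank = K) :
    (∀ b, step v δ x y b = b ↔ IsPoissonEstimate v x y b) ∧
      ∀ b₀ b, Tendsto (iter v δ x y b₀) atTop (𝓝 b) → IsPoissonEstimate v x y b := by
  have hU := (isUnit_gram_iff x).2 hx
  have h1 : ∀ b, step v δ x y b = b ↔ IsPoissonEstimate v x y b := fun b => by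
    rw [step_eq_self_iff hδ x y hy hU, sum_grad_eq_zero_iff_isPoissonEstimate hδ]
  refine ⟨h1, fun b₀ b hb => (h1 b).1 ?_⟩
  have hc : Continuous (step v δ x y) := by
    rw [funext (step_eq hδ x y hy hU)]
    have : Continuous fun φ => ∑ i, grad v δ (x i) (y i) φ :=
      continuous_finsetSum _ fun i _ => continuous_grad v δ continuous_const continuous_const
        continuous_id
    fun_prop
  exact isFixedPt_of_tendsto_iterate hb hc.continuousAt

/-- A Poisson estimate is unique if the pseudo-Hessian is nonsingular at some point. -/
theorem eq_of_sum_grad_eq_zero (hδ : 0 < δ) (x : Fin n → Vec K) (y : Fin n → ℝ)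
    (hy : ∀ i, 0 ≤ y i) {φ : Vec K} (hinj : ∀ a, ∑ i, gradDeriv v δ (x i) (y i) φ a = 0 → a = 0)
    {b b' : Vec K} (hb : ∑ i, grad v δ (x i) (y i) b = 0)
    (hb' : ∑ i, grad v δ (x i) (y i) b' = 0) : b' = b := by
  rw [sum_grad_eq_zero_iff hδ] at hb hb'
  rw [← sub_eq_zero]
  refine hinj _ (Finset.sum_eq_zero fun i _ => ?_)
  -- Pairing the difference of the two score equations with `b' - b` gives a sum of nonpositive
  -- terms, so every term vanishes and `b' - b` is in the kernel of the pseudo-Hessian.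
  have h0 : ∑ i, (inner ℝ (x i) b' - inner ℝ (x i) b) *
      (err v (y i) (inner ℝ (x i) b') - err v (y i) (inner ℝ (x i) b)) = 0 := by
    have h1 := congrArg (fun u => (inner ℝ u (b' - b) : ℝ)) hb
    have h2 := congrArg (fun u => (inner ℝ u (b' - b) : ℝ)) hb'
    simp only [sum_inner, inner_smul_left, inner_zero_left, inner_sub_right] at h1 h2
    have h3 := congrArg₂ (· - ·) h2 h1
    simp only [← Finset.sum_sub_distrib, sub_zero] at h3
    rw [← h3]
    refine Finset.sum_congr rfl fun i _ => ?_
    simp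
    ring
  have h1 := (Finset.sum_eq_zero_iff_of_nonpos
    fun i _ => err_strictAntitone (v := v) (hy i)).1 h0 i (Finset.mem_univ i)
  rw [gradDeriv_apply, inner_sub_right, weight_eq_one_or_eq_of_err h1, zero_smul]

end Sample

/-! ### Population score and pseudo-Hessian: integrability and matrix forms -/

section PopulationFunctions

variable {Ω : Type*} [MeasurableSpace Ω] {K : ℕ}

/-- `E[grad]`, the negative of the expected score. -/
noncomputable def popGrad (v : Form) (δ : ℝ) (μ : Measure Ω) (X : Ω → Vec K) (Y : Ω → ℝ)
    (φ : Vec K) : Vec K := ∫ ω, grad v δ (X ω) (Y ω) φ ∂μ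

/-- `E[(1 - w(φ)) X X']` as an operator. -/
noncomputable def popDeriv (v : Form) (δ : ℝ) (μ : Measure Ω) (X : Ω → Vec K) (Y : Ω → ℝ)
    (φ : Vec K) : Vec K →L[ℝ] Vec K := ∫ ω, gradDeriv v δ (X ω) (Y ω) φ ∂μ

/-- `E[X X']` as an operator. -/
noncomputable def popOuter (μ : Measure Ω) (X : Ω → Vec K) : Vec K →L[ℝ] Vec K :=
  ∫ ω, rankOne ℝ (X ω) (X ω) ∂μ

theorem continuous_weight (v : Form) (δ : ℝ) {α : Type*} [TopologicalSpace α] {x φ : α → Vec K}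
    {y : α → ℝ} (hx : Continuous x) (hy : Continuous y) (hφ : Continuous φ) :
    Continuous fun a => weight v δ (y a) (inner ℝ (x a) (φ a)) := by
  cases v <;> simp only [weight] <;> fun_prop

theorem continuous_rankOne_self {α : Type*} [TopologicalSpace α] {x : α → Vec K}
    (hx : Continuous x) : Continuous fun a => rankOne ℝ (x a) (x a) :=
  (((rankOne ℝ : Vec K →L[ℝ] _).continuous.comp hx)).clm_apply hx

theorem continuous_gradDeriv (v : Form) (δ : ℝ) {α : Type*} [TopologicalSpace α]
    {x φ : α → Vec K} {y : α → ℝ} (hx : Continuous x) (hy : Continuous y) (hφ : Continuous φ) :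
    Continuous fun a => gradDeriv v δ (x a) (y a) (φ a) :=
  (continuous_const.sub (continuous_weight v δ hx hy hφ)).smul (continuous_rankOne_self hx)

variable {μ : Measure Ω} {v : Form} {δ : ℝ} {X : Ω → Vec K} {Y : Ω → ℝ} {β : Vec K}
  {L : Vec K ≃L[ℝ] Vec K} {r : ℝ}

theorem norm_gradDeriv_le (x : Vec K) (y : ℝ) (φ : Vec K) :
    ‖gradDeriv v δ x y φ‖ ≤ ‖x‖ ^ 2 + ‖x‖ ^ 2 * |weight v δ y (inner ℝ x φ)| := by
  rw [gradDeriv, norm_smul, InnerProductSpace.norm_rankOne, Real.norm_eq_abs, ← sq]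
  have := abs_sub (1 : ℝ) (weight v δ y (inner ℝ x φ))
  rw [abs_one] at this
  nlinarith [sq_nonneg ‖x‖]

theorem integrable_norm_sq (hX2 : MemLp X 2 μ) : Integrable (fun ω => ‖X ω‖ ^ 2) μ :=
  hX2.norm.integrable_sq

theorem integrable_rankOne (hX : Measurable X) (hX2 : MemLp X 2 μ) :
    Integrable (fun ω => rankOne ℝ (X ω) (X ω)) μ := by
  refine (integrable_norm_sq hX2).mono' ?_ (Eventually.of_forall fun ω => ?_)
  · exact ((continuous_rankOne_self continuous_id).comp_stronglyMeasurable
      hX.stronglyMeasurable).aestronglyMeasurable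
  · rw [InnerProductSpace.norm_rankOne, sq]

theorem exists_dominating_gradDeriv (hX2 : MemLp X 2 μ)
    (hdom : DominatedOn v δ μ X Y (ball L β r)) :
    ∃ g : Ω → ℝ, Integrable g μ ∧
      ∀ᵐ ω ∂μ, ∀ φ ∈ ball L β r, ‖gradDeriv v δ (X ω) (Y ω) φ‖ ≤ g ω := by
  obtain ⟨g, hg, hle⟩ := hdom
  refine ⟨_, (integrable_norm_sq hX2).add hg, ?_⟩
  filter_upwards [hle] with ω hω φ hφ
  refine (norm_gradDeriv_le _ _ _).trans ?_
  simp only [Pi.add_apply]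
  gcongr
  exact hω φ hφ

/-- Regularity of the ball only controls the derivative. The gradient is dominated by its value at
`β`, which is the score up to sign, plus the derivative bound times the radius. -/
theorem exists_dominating_grad (hδ : 0 < δ) (hr : 0 < r) (hX2 : MemLp X 2 μ)
    (hdom : DominatedOn v δ μ X Y (ball L β r)) (hscore : Integrable (score v δ X Y β) μ) :
    ∃ g : Ω → ℝ, Integrable g μ ∧
      ∀ᵐ ω ∂μ, ∀ φ ∈ ball L β r, ‖grad v δ (X ω) (Y ω) φ‖ ≤ g ω := by
  obtain ⟨g, hg, hle⟩ := exists_dominating_gradDeriv hX2 hdom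
  set R := ‖(L.symm : Vec K →L[ℝ] Vec K)‖ * r with hR
  refine ⟨_, hscore.norm.add (hg.mul_const R), ?_⟩
  filter_upwards [hle] with ω hω φ hφ
  have h1 := (IsC1Limit.of_hasFDerivAt (S := ball L β r)
    fun φ _ => hasFDerivAt_grad (v := v) hδ (X ω) (Y ω) φ).norm_sub_sub_le subset_rfl
    (convex_ball L β r) (c := 0) (k := g ω) (fun x hx => by
      rw [sub_zero]
      exact hω x hx) hφ (mem_ball_self L β hr.le)
  have h0 : 0 ≤ g ω := (norm_nonneg _).trans (hω φ hφ)
  have h2 : ‖φ - β‖ ≤ R := (norm_le_symm_mul L _).trans (by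
    rw [hR]; gcongr; exact hφ)
  have h3 : ‖grad v δ (X ω) (Y ω) β‖ = ‖score v δ X Y β ω‖ := by
    rw [grad, score, norm_neg]
  simp only [Pi.add_apply, ← h3]
  rw [zero_apply, sub_zero] at h1
  rw [← add_sub_cancel (grad v δ (X ω) (Y ω) β) (grad v δ (X ω) (Y ω) φ)]
  exact (norm_add_le _ _).trans (add_le_add le_rfl (h1.trans (by gcongr)))

theorem integrable_of_dominated {F : Type*} [NormedAddCommGroup F] {S : Set (Vec K)}
    (hX : Measurable X) (hYm : Measurable Y)
    {Φ : Vec K × ℝ → Vec K → F} (hΦ : Continuous fun q : (Vec K × ℝ) × Vec K => Φ q.1 q.2)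
    {g : Ω → ℝ} (hg : Integrable g μ) (hle : ∀ᵐ ω ∂μ, ∀ φ ∈ S, ‖Φ (X ω, Y ω) φ‖ ≤ g ω)
    {φ : Vec K} (hφ : φ ∈ S) : Integrable (fun ω => Φ (X ω, Y ω) φ) μ := by
  refine hg.mono' ?_ (hle.mono fun ω h => h φ hφ)
  exact ((hΦ.comp (Continuous.prodMk_left φ)).comp_stronglyMeasurable
    (hX.prodMk hYm).stronglyMeasurable).aestronglyMeasurable

theorem integrable_grad (hδ : 0 < δ) (hr : 0 < r) (hX : Measurable X) (hYm : Measurable Y)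
    (hX2 : MemLp X 2 μ) (hdom : DominatedOn v δ μ X Y (ball L β r))
    (hscore : Integrable (score v δ X Y β) μ) {φ : Vec K} (hφ : φ ∈ ball L β r) :
    Integrable (fun ω => grad v δ (X ω) (Y ω) φ) μ := by
  obtain ⟨g, hg, hle⟩ := exists_dominating_grad hδ hr hX2 hdom hscore
  exact integrable_of_dominated hX hYm (Φ := fun p φ => grad v δ p.1 p.2 φ)
    (continuous_grad v δ (by fun_prop) (by fun_prop) (by fun_prop)) hg hle hφ

theorem integrable_gradDeriv (hX : Measurable X) (hYm : Measurable Y)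
    (hX2 : MemLp X 2 μ) (hdom : DominatedOn v δ μ X Y (ball L β r)) {φ : Vec K}
    (hφ : φ ∈ ball L β r) : Integrable (fun ω => gradDeriv v δ (X ω) (Y ω) φ) μ := by
  obtain ⟨g, hg, hle⟩ := exists_dominating_gradDeriv hX2 hdom
  exact integrable_of_dominated hX hYm (Φ := fun p φ => gradDeriv v δ p.1 p.2 φ)
    (continuous_gradDeriv v δ (by fun_prop) (by fun_prop) (by fun_prop)) hg hle hφ

theorem continuousOn_popDeriv (hX : Measurable X) (hYm : Measurable Y)
    (hX2 : MemLp X 2 μ) (hdom : DominatedOn v δ μ X Y (ball L β r)) :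
    ContinuousOn (popDeriv v δ μ X Y) (ball L β r) := by
  obtain ⟨g, hg, hle⟩ := exists_dominating_gradDeriv hX2 hdom
  refine continuousOn_of_dominated (bound := g)
    (fun φ hφ => (integrable_gradDeriv hX hYm hX2 hdom hφ).aestronglyMeasurable)
    (fun φ hφ => hle.mono fun ω h => h φ hφ) hg (Eventually.of_forall fun ω => ?_)
  exact (continuous_gradDeriv v δ continuous_const continuous_const continuous_id).continuousOn

theorem toEuclideanCLM_integral {T : Ω → Vec K →L[ℝ] Vec K} (hT : Integrable T μ)
    {A : Matrix (Fin K) (Fin K) ℝ}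
    (hA : ∀ k l, A k l = ∫ ω, T ω (EuclideanSpace.single l 1) k ∂μ) :
    Matrix.toEuclideanCLM (𝕜 := ℝ) A = ∫ ω, T ω ∂μ := by
  rw [toEuclideanCLM_eq_iff]
  intro k l
  rw [hA, ContinuousLinearMap.integral_apply hT]
  exact (EuclideanSpace.proj (𝕜 := ℝ) k).integral_comp_comm
    (hT.apply_continuousLinearMap (EuclideanSpace.single l 1))

theorem toEuclideanCLM_secondMoment (hX : Measurable X) (hX2 : MemLp X 2 μ) :
    Matrix.toEuclideanCLM (𝕜 := ℝ) (secondMoment μ X) = popOuter μ X := by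
  refine toEuclideanCLM_integral (integrable_rankOne hX hX2) fun k l => ?_
  simp [secondMoment, inner_single_one, mul_comm]

theorem toEuclideanCLM_popBread {φ : Vec K}
    (h : Integrable (fun ω => gradDeriv v δ (X ω) (Y ω) φ) μ) :
    Matrix.toEuclideanCLM (𝕜 := ℝ) (popBread v δ μ X Y φ) = popDeriv v δ μ X Y φ := by
  refine toEuclideanCLM_integral h fun k l => ?_
  simp [popBread, gradDeriv_apply, inner_single_one, mul_assoc, mul_comm (X _ k)]

theorem isUnit_popOuter (hX : Measurable X) (hX2 : MemLp X 2 μ)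
    (hrank : (secondMoment μ X).PosDef) : IsUnit (popOuter μ X) := by
  rw [← toEuclideanCLM_secondMoment hX hX2, isUnit_toEuclideanCLM_iff]
  exact hrank.isUnit

theorem popMap_eq (hδ : 0 < δ) (hX : Measurable X) (hX2 : MemLp X 2 μ) (hYn : ∀ ω, 0 ≤ Y ω)
    (hrank : (secondMoment μ X).PosDef) {φ : Vec K}
    (h : Integrable (fun ω => grad v δ (X ω) (Y ω) φ) μ) :
    popMap v δ μ X Y φ = φ - Ring.inverse (popOuter μ X) (popGrad v δ μ X Y φ) := by
  have hQ := integrable_rankOne hX hX2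
  have hQφ := hQ.apply_continuousLinearMap φ
  have h1 : (WithLp.toLp 2 fun k => ∫ ω, X ω k * transformed v δ (Y ω) (inner ℝ (X ω) φ) ∂μ) =
      popOuter μ X φ - popGrad v δ μ X Y φ := by
    rw [popOuter, popGrad, ContinuousLinearMap.integral_apply hQ, ← integral_sub hQφ h]
    ext k
    have h2 := (EuclideanSpace.proj (𝕜 := ℝ) k).integral_comp_comm (hQφ.sub h)
    refine Eq.trans ?_ h2
    refine integral_congr_ae (Eventually.of_forall fun ω => ?_)
    simp only [transformed_eq hδ (hYn ω)]
    simp [grad]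
    ring
  have h2 : popMap v δ μ X Y φ = Matrix.toEuclideanCLM (𝕜 := ℝ) (secondMoment μ X)⁻¹
      (WithLp.toLp 2 fun k => ∫ ω, X ω k * transformed v δ (Y ω) (inner ℝ (X ω) φ) ∂μ) := rfl
  rw [h2, h1, toEuclideanCLM_inv hrank.isUnit, toEuclideanCLM_secondMoment hX hX2, map_sub,
    inverse_apply_apply (isUnit_popOuter hX hX2 hrank)]

theorem popGrad_self (hexog : ∫ ω, err v (Y ω) (inner ℝ (X ω) β) • X ω ∂μ = 0) :
    popGrad v δ μ X Y β = 0 := by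
  have : (fun ω => grad v δ (X ω) (Y ω) β) =
      fun ω => (-(1 + δ)⁻¹) • (err v (Y ω) (inner ℝ (X ω) β) • X ω) := by
    ext1 ω
    rw [grad, smul_smul, ← neg_smul]
    congr 1
    ring
  rw [popGrad, this, integral_smul, hexog, smul_zero]

theorem inner_popDeriv {φ : Vec K} (h : Integrable (fun ω => gradDeriv v δ (X ω) (Y ω) φ) μ)
    (a c : Vec K) : inner ℝ c (popDeriv v δ μ X Y φ a) =
      ∫ ω, (1 - weight v δ (Y ω) (inner ℝ (X ω) φ)) * (inner ℝ (X ω) a * inner ℝ (X ω) c) ∂μ := by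
  rw [popDeriv, ContinuousLinearMap.integral_apply h,
    ← integral_inner (h.apply_continuousLinearMap a)]
  refine integral_congr_ae (Eventually.of_forall fun ω => ?_)
  simp only [gradDeriv_apply, inner_smul_right, real_inner_comm]
  ring

theorem inner_popOuter (hX : Measurable X) (hX2 : MemLp X 2 μ) (a c : Vec K) :
    inner ℝ c (popOuter μ X a) = ∫ ω, inner ℝ (X ω) a * inner ℝ (X ω) c ∂μ := by
  have h := integrable_rankOne hX hX2
  rw [popOuter, ContinuousLinearMap.integral_apply h,
    ← integral_inner (h.apply_continuousLinearMap a)]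
  refine integral_congr_ae (Eventually.of_forall fun ω => ?_)
  simp [inner_smul_right, real_inner_comm]

end PopulationFunctions

/-! ### Sample averages and uniform laws of large numbers -/

section Averages

variable {Ω : Type*} {K : ℕ}

/-- Sample average of `grad`. -/
noncomputable def avgGrad (v : Form) (δ : ℝ) (X : ℕ → Ω → Vec K) (Y : ℕ → Ω → ℝ) (p : ℕ × Ω)
    (φ : Vec K) : Vec K := (p.1 : ℝ)⁻¹ • ∑ i : Fin p.1, grad v δ (X i p.2) (Y i p.2) φ

/-- Sample average of `gradDeriv`. -/
noncomputable def avgDeriv (v : Form) (δ : ℝ) (X : ℕ → Ω → Vec K) (Y : ℕ → Ω → ℝ) (p : ℕ × Ω)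
    (φ : Vec K) : Vec K →L[ℝ] Vec K :=
  (p.1 : ℝ)⁻¹ • ∑ i : Fin p.1, gradDeriv v δ (X i p.2) (Y i p.2) φ

/-- Sample average of `XX'`. -/
noncomputable def avgOuter (X : ℕ → Ω → Vec K) (p : ℕ × Ω) : Vec K →L[ℝ] Vec K :=
  (p.1 : ℝ)⁻¹ • ∑ i : Fin p.1, rankOne ℝ (X i p.2) (X i p.2)

variable {v : Form} {δ : ℝ} {X : ℕ → Ω → Vec K} {Y : ℕ → Ω → ℝ} {β : Vec K}
  {L : Vec K ≃L[ℝ] Vec K} {r : ℝ}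

theorem hasFDerivAt_avgGrad (hδ : 0 < δ) (p : ℕ × Ω) (φ : Vec K) :
    HasFDerivAt (avgGrad v δ X Y p) (avgDeriv v δ X Y p φ) φ := by
  have := (HasFDerivAt.fun_sum (u := Finset.univ) fun (i : Fin p.1) _ =>
    hasFDerivAt_grad (v := v) hδ (X i p.2) (Y i p.2) φ).const_smul (p.1 : ℝ)⁻¹
  exact this

theorem isC1Limit_avgGrad (hδ : 0 < δ) (S : Set (Vec K)) (p : ℕ × Ω) :
    IsC1Limit S (avgGrad v δ X Y p) (avgDeriv v δ X Y p) :=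
  IsC1Limit.of_hasFDerivAt fun φ _ => hasFDerivAt_avgGrad hδ p φ

theorem isUnit_of_isUnit_smul {R : Type*} [Ring R] [Algebra ℝ R] {c : ℝ} {T : R}
    (h : IsUnit (c • T)) : IsUnit T := by
  refine ⟨⟨T, c • Ring.inverse (c • T), ?_, ?_⟩, rfl⟩
  · rw [mul_smul_comm, ← smul_mul_assoc, Ring.mul_inverse_cancel _ h]
  · rw [smul_mul_assoc, ← mul_smul_comm, Ring.inverse_mul_cancel _ h]

theorem isUnit_gram_of_isUnit_avgOuter {p : ℕ × Ω} (hp : IsUnit (avgOuter X p)) :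
    IsUnit ((design fun i : Fin p.1 => X i p.2).transpose * design fun i : Fin p.1 => X i p.2) := by
  rw [← isUnit_toEuclideanCLM_iff, toEuclideanCLM_gram]
  rw [avgOuter] at hp
  exact isUnit_of_isUnit_smul hp

/-- The factors `n⁻¹` in the two averages cancel, so the step has the same form as the population
map. -/
theorem step_eq_avg (hδ : 0 < δ) (hY : ∀ i ω, 0 ≤ Y i ω) {p : ℕ × Ω}
    (hp : IsUnit (avgOuter X p)) (φ : Vec K) :
    step v δ (fun i : Fin p.1 => X i p.2) (fun i => Y i p.2) φ =
      φ - Ring.inverse (avgOuter X p) (avgGrad v δ X Y p φ) := by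
  have hx := isUnit_gram_of_isUnit_avgOuter hp
  have hU : IsUnit (∑ i : Fin p.1, rankOne ℝ (X i p.2) (X i p.2)) := by
    rw [← toEuclideanCLM_gram fun i : Fin p.1 => X i p.2, isUnit_toEuclideanCLM_iff]; exact hx
  rw [step_eq hδ _ _ (fun i => hY i p.2) hx]
  congr 1
  set a := ∑ i : Fin p.1, grad v δ (X i p.2) (Y i p.2) φ with ha
  have h1 : avgGrad v δ X Y p φ = avgOuter X p
      (Ring.inverse (∑ i : Fin p.1, rankOne ℝ (X i p.2) (X i p.2)) a) := by
    rw [avgOuter, smul_apply, apply_inverse_apply hU, avgGrad]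
  rw [h1, inverse_apply_apply hp]

variable [MeasurableSpace Ω] {μ : Measure Ω}

/-- Iid observations with nonnegative responses. -/
structure IsSampling (μ : Measure Ω) (X : ℕ → Ω → Vec K) (Y : ℕ → Ω → ℝ) : Prop where
  measurable_X : ∀ i, Measurable (X i)
  measurable_Y : ∀ i, Measurable (Y i)
  nonneg : ∀ i ω, 0 ≤ Y i ω
  indep : iIndepFun (fun i ω => (X i ω, Y i ω)) μ
  ident : ∀ i, IdentDistrib (fun ω => (X i ω, Y i ω)) (fun ω => (X 0 ω, Y 0 ω)) μ μ

variable [IsProbabilityMeasure μ]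

/-- The uniform law of large numbers over a compact parameter set. -/
theorem IsSampling.uniform_law (h : IsSampling μ X Y) {F : Type*} [NormedAddCommGroup F]
    [NormedSpace ℝ F] [CompleteSpace F] {S : Set (Vec K)} [CompactSpace S]
    {Φ : Vec K × ℝ → Vec K → F} (hΦ : Continuous fun q : (Vec K × ℝ) × Vec K => Φ q.1 q.2)
    {g : Ω → ℝ} (hg : Integrable g μ) (hle : ∀ᵐ ω ∂μ, ∀ φ ∈ S, ‖Φ (X 0 ω, Y 0 ω) φ‖ ≤ g ω)
    {ε : ℝ} (hε : 0 < ε) :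
    ∀ᶠ p in probOne μ, ∀ φ ∈ S, ‖((p.1 : ℝ)⁻¹ • ∑ i : Fin p.1, Φ (X i p.2, Y i p.2) φ) -
      ∫ ω, Φ (X 0 ω, Y 0 ω) φ ∂μ‖ ≤ ε := by
  have hm := fun i => (h.measurable_X i).prodMk (h.measurable_Y i)
  -- Each observation is viewed as a random element of the Banach space `C(S, F)`; the law of large
  -- numbers in the supremum norm is the uniform law.
  set Ψ : Vec K × ℝ → C(S, F) := fun p =>
    ⟨fun φ => Φ p φ, hΦ.comp (continuous_const.prodMk continuous_subtype_val)⟩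
  have hΨ : Continuous Ψ := ContinuousMap.continuous_of_continuous_uncurry _
    (hΦ.comp (continuous_fst.prodMk (continuous_subtype_val.comp continuous_snd)))
  have hint : Integrable (fun ω => Ψ (X 0 ω, Y 0 ω)) μ := by
    refine hg.norm.mono' (hΨ.comp_stronglyMeasurable (hm 0).stronglyMeasurable).aestronglyMeasurable
      ?_
    filter_upwards [hle] with ω hω
    exact (ContinuousMap.norm_le _ (norm_nonneg _)).2 fun φ =>
      (hω φ φ.2).trans (le_abs_self _)
  have := tendsto_average_probOne hΨ (W := fun i ω => (X i ω, Y i ω)) hm h.indep h.ident hint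
  filter_upwards [Metric.tendsto_nhds.1 this ε hε] with p hp φ hφ
  rw [dist_eq_norm] at hp
  refine le_trans (le_of_eq ?_) ((ContinuousMap.norm_coe_le_norm _ ⟨φ, hφ⟩).trans hp.le)
  have h1 : (∫ ω, Ψ (X 0 ω, Y 0 ω) ∂μ) ⟨φ, hφ⟩ = ∫ ω, Φ (X 0 ω, Y 0 ω) φ ∂μ :=
    ((ContinuousMap.evalCLM ℝ (⟨φ, hφ⟩ : S)).integral_comp_comm hint).symm
  rw [ContinuousMap.sub_apply, h1]
  simp [Ψ]

theorem IsSampling.tendsto_avgOuter (h : IsSampling μ X Y) (hX2 : MemLp (X 0) 2 μ) :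
    Tendsto (avgOuter X) (probOne μ) (𝓝 (popOuter μ (X 0))) :=
  tendsto_average_probOne (Φ := fun p : Vec K × ℝ => rankOne ℝ p.1 p.1)
    (continuous_rankOne_self continuous_fst) (W := fun i ω => (X i ω, Y i ω))
    (fun i => (h.measurable_X i).prodMk (h.measurable_Y i)) h.indep h.ident
    (integrable_rankOne (h.measurable_X 0) hX2)

theorem IsSampling.avgGrad_close (h : IsSampling μ X Y) (hδ : 0 < δ) (hr : 0 < r)
    (hX2 : MemLp (X 0) 2 μ) (hdom : DominatedOn v δ μ (X 0) (Y 0) (ball L β r))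
    (hscore : Integrable (score v δ (X 0) (Y 0) β) μ) {ε : ℝ} (hε : 0 < ε) :
    ∀ᶠ p in probOne μ, ∀ φ ∈ ball L β r,
      ‖avgGrad v δ X Y p φ - popGrad v δ μ (X 0) (Y 0) φ‖ ≤ ε := by
  obtain ⟨g, hg, hle⟩ := exists_dominating_grad hδ hr hX2 hdom hscore
  exact h.uniform_law (Φ := fun p φ => grad v δ p.1 p.2 φ)
    (continuous_grad v δ (by fun_prop) (by fun_prop) (by fun_prop)) hg hle hε

theorem IsSampling.avgDeriv_close (h : IsSampling μ X Y)
    (hX2 : MemLp (X 0) 2 μ) (hdom : DominatedOn v δ μ (X 0) (Y 0) (ball L β r))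
    {ε : ℝ} (hε : 0 < ε) :
    ∀ᶠ p in probOne μ, ∀ φ ∈ ball L β r,
      ‖avgDeriv v δ X Y p φ - popDeriv v δ μ (X 0) (Y 0) φ‖ ≤ ε := by
  obtain ⟨g, hg, hle⟩ := exists_dominating_gradDeriv hX2 hdom
  exact h.uniform_law (Φ := fun p φ => gradDeriv v δ p.1 p.2 φ)
    (continuous_gradDeriv v δ (by fun_prop) (by fun_prop) (by fun_prop)) hg hle hε

/-- Both uniform laws hold at once with probability tending to one, so some sample point satisfies
them; its averages form the approximating pair. -/
theorem IsSampling.isC1Limit_popGrad (h : IsSampling μ X Y) (hδ : 0 < δ) (hr : 0 < r)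
    (hX2 : MemLp (X 0) 2 μ) (hdom : DominatedOn v δ μ (X 0) (Y 0) (ball L β r))
    (hscore : Integrable (score v δ (X 0) (Y 0) β) μ) :
    IsC1Limit (ball L β r) (popGrad v δ μ (X 0) (Y 0)) (popDeriv v δ μ (X 0) (Y 0)) := by
  intro ε hε
  obtain ⟨p, h1, h2⟩ := ((h.avgGrad_close hδ hr hX2 hdom hscore hε).and
    (h.avgDeriv_close hX2 hdom hε)).exists
  exact ⟨avgGrad v δ X Y p, avgDeriv v δ X Y p, fun φ hφ =>
    ⟨hasFDerivAt_avgGrad hδ p φ, h1 φ hφ, h2 φ hφ⟩⟩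

end Averages

/-! ### The population map: derivative, strict rate, sufficient condition -/

section Contraction

variable {Ω : Type*} [MeasurableSpace Ω] {K : ℕ} {μ : Measure Ω} {v : Form} {δ : ℝ}
  {X : Ω → Vec K} {Y : Ω → ℝ} {β : Vec K} {L : Vec K ≃L[ℝ] Vec K} {r κ : ℝ}

theorem IsC1Limit.congr {E : Type*} [NormedAddCommGroup E] [NormedSpace ℝ E] {S : Set E}
    {f g : E → E} {f' : E → E →L[ℝ] E} (h : IsC1Limit S f f') (hfg : ∀ x ∈ S, f x = g x) :
    IsC1Limit S g f' := by
  intro ε hε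
  obtain ⟨F, F', hF⟩ := h ε hε
  exact ⟨F, F', fun x hx => by rw [← hfg x hx]; exact hF x hx⟩

theorem IsC1Limit.hasFDerivAt {f : Vec K → Vec K} {f' : Vec K → Vec K →L[ℝ] Vec K}
    (h : IsC1Limit (ball L β r) f f') (hc : ContinuousOn f' (ball L β r)) {φ : Vec K}
    (hφ : ball L β r ∈ 𝓝 φ) : HasFDerivAt f (f' φ) φ := by
  refine HasFDerivAt.of_isLittleO (Asymptotics.isLittleO_iff.2 fun ε hε => ?_)
  have h1 : ∀ᶠ x in 𝓝 φ, ‖f' x - f' φ‖ < ε := by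
    simpa only [dist_eq_norm] using Metric.continuousAt_iff'.1 (hc.continuousAt hφ) ε hε
  obtain ⟨ρ, hρ, hsub⟩ := exists_ball_subset L φ (h1.and hφ)
  filter_upwards [ball_mem_nhds L φ hρ] with x hx
  exact h.norm_sub_sub_le (fun z hz => (hsub hz).2) (convex_ball L φ ρ)
    (fun z hz => (hsub hz).1.le) hx (mem_ball_self L φ hρ.le)

/-- A local Lipschitz constant bounds the derivative; conjugating by `L` makes this a statement
about the ordinary operator norm. -/
theorem IsC1Limit.norm_deriv_le {f : Vec K → Vec K} {f' : Vec K → Vec K →L[ℝ] Vec K}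
    (h : IsC1Limit (ball L β r) f f') (hc : ContinuousOn f' (ball L β r)) (hκ : 0 ≤ κ)
    (hcon : IsContractionOn L κ f (ball L β r)) {φ : Vec K}
    (hφ : ball L β r ∈ 𝓝 φ) (a : Vec K) : ‖L (f' φ a)‖ ≤ κ * ‖L a‖ := by
  have hd := h.hasFDerivAt hc hφ
  have hd' : HasFDerivAt (fun u => L (f (L.symm u)))
      ((L : Vec K →L[ℝ] Vec K).comp ((f' φ).comp (L.symm : Vec K →L[ℝ] Vec K))) (L φ) := by
    refine (L : Vec K →L[ℝ] Vec K).hasFDerivAt.comp (L φ) ?_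
    refine HasFDerivAt.comp (L φ) ?_ (L.symm : Vec K →L[ℝ] Vec K).hasFDerivAt
    simpa using hd
  have hmem : ∀ᶠ u in 𝓝 (L φ), L.symm u ∈ ball L β r := by
    refine L.symm.continuous.continuousAt.eventually_mem ?_
    simpa using hφ
  have h1 := hd'.le_of_lip' hκ (by
    filter_upwards [hmem] with u hu
    have := hcon _ hu _ (mem_of_mem_nhds hφ)
    simpa [map_sub] using this)
  have h2 := ContinuousLinearMap.le_of_opNorm_le _ h1 (L a)
  simpa using h2

/-- The derivative of the population mapping. -/
noncomputable def popMapDeriv (v : Form) (δ : ℝ) (μ : Measure Ω) (X : Ω → Vec K) (Y : Ω → ℝ)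
    (φ : Vec K) : Vec K →L[ℝ] Vec K :=
  ContinuousLinearMap.id ℝ (Vec K) -
    (Ring.inverse (popOuter μ X)).comp (popDeriv v δ μ X Y φ)

/-- A vector killed by `popDeriv` is fixed by the derivative of `M`, which strictly shrinks nonzero
vectors. -/
theorem isUnit_popDeriv (hκ : κ < 1)
    (hd : ∀ a, ‖L (popMapDeriv v δ μ X Y β a)‖ ≤ κ * ‖L a‖) : IsUnit (popDeriv v δ μ X Y β) := by
  have hinj : Function.Injective (popDeriv v δ μ X Y β) := by
    refine (injective_iff_map_eq_zero _).2 fun a ha => ?_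
    have h1 := hd a
    rw [popMapDeriv] at h1
    simp only [sub_apply, ContinuousLinearMap.comp_apply, ha, map_zero, sub_zero,
      ContinuousLinearMap.id_apply] at h1
    have h2 : ‖L a‖ = 0 := by nlinarith [norm_nonneg (L a)]
    simpa using h2
  rw [ContinuousLinearMap.isUnit_iff_bijective]
  have hsurj := (LinearMap.injective_iff_surjective
    (f := (popDeriv v δ μ X Y β).toLinearMap)).1 hinj
  exact ⟨hinj, hsurj⟩

/-- The conditions on one observation, on a regular ball. -/
structure IsRegular (v : Form) (δ : ℝ) (μ : Measure Ω) (X : Ω → Vec K) (Y : Ω → ℝ) (β : Vec K)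
    (L : Vec K ≃L[ℝ] Vec K) (r : ℝ) : Prop where
  delta_pos : 0 < δ
  r_pos : 0 < r
  measurable_X : Measurable X
  measurable_Y : Measurable Y
  nonneg : ∀ ω, 0 ≤ Y ω
  memLp : MemLp X 2 μ
  posDef : (secondMoment μ X).PosDef
  exog : ∫ ω, err v (Y ω) (inner ℝ (X ω) β) • X ω ∂μ = 0
  score : Integrable (score v δ X Y β) μ
  dominated : DominatedOn v δ μ X Y (ball L β r)
  isC1Limit : IsC1Limit (ball L β r) (popGrad v δ μ X Y) (popDeriv v δ μ X Y)

namespace IsRegular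

theorem popMap_eq (h : IsRegular v δ μ X Y β L r) {φ : Vec K} (hφ : φ ∈ ball L β r) :
    popMap v δ μ X Y φ = φ - Ring.inverse (popOuter μ X) (popGrad v δ μ X Y φ) :=
  IOLS.popMap_eq h.delta_pos h.measurable_X h.memLp h.nonneg h.posDef
    (integrable_grad h.delta_pos h.r_pos h.measurable_X h.measurable_Y h.memLp h.dominated
      h.score hφ)

theorem mem_ball (h : IsRegular v δ μ X Y β L r) : β ∈ ball L β r := mem_ball_self L β h.r_pos.le

theorem popGrad_self (h : IsRegular v δ μ X Y β L r) : popGrad v δ μ X Y β = 0 :=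
  IOLS.popGrad_self h.exog

theorem popMap_self (h : IsRegular v δ μ X Y β L r) : popMap v δ μ X Y β = β := by
  rw [h.popMap_eq h.mem_ball, h.popGrad_self, map_zero, sub_zero]

theorem isC1Limit_popMap (h : IsRegular v δ μ X Y β L r) :
    IsC1Limit (ball L β r) (popMap v δ μ X Y) (popMapDeriv v δ μ X Y) :=
  ((IsC1Limit.of_hasFDerivAt fun φ _ => hasFDerivAt_id φ).sub
    (h.isC1Limit.clm_comp (Ring.inverse (popOuter μ X)))).congr fun _ hφ => (h.popMap_eq hφ).symm

theorem continuousOn_popDeriv (h : IsRegular v δ μ X Y β L r) :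
    ContinuousOn (popDeriv v δ μ X Y) (ball L β r) :=
  IOLS.continuousOn_popDeriv h.measurable_X h.measurable_Y h.memLp h.dominated

theorem continuousOn_popMapDeriv (h : IsRegular v δ μ X Y β L r) :
    ContinuousOn (popMapDeriv v δ μ X Y) (ball L β r) :=
  continuousOn_const.sub (continuousOn_const.clm_comp h.continuousOn_popDeriv)

theorem integrable_gradDeriv (h : IsRegular v δ μ X Y β L r) :
    Integrable (fun ω => gradDeriv v δ (X ω) (Y ω) β) μ :=
  IOLS.integrable_gradDeriv h.measurable_X h.measurable_Y h.memLp h.dominated h.mem_ball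

theorem isUnit_popOuter (h : IsRegular v δ μ X Y β L r) : IsUnit (popOuter μ X) :=
  IOLS.isUnit_popOuter h.measurable_X h.memLp h.posDef

theorem popBread_posSemidef (h : IsRegular v δ μ X Y β L r) :
    (popBread v δ μ X Y β).PosSemidef := by
  refine .of_dotProduct_mulVec_nonneg ?_ fun a => ?_
  · ext k l
    simp [popBread, mul_comm (X _ k)]
  · have h1 := Matrix.inner_toEuclideanCLM (popBread v δ μ X Y β) (WithLp.toLp 2 a)
      (WithLp.toLp 2 a)
    rw [toEuclideanCLM_popBread h.integrable_gradDeriv,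
      inner_popDeriv h.integrable_gradDeriv] at h1
    simp only [star_trivial]
    rw [← h1]
    exact integral_nonneg fun ω =>
      mul_nonneg (one_sub_weight_nonneg h.delta_pos (h.nonneg ω)) (mul_self_nonneg _)

theorem popBread_posDef (h : IsRegular v δ μ X Y β L r)
    (hU : IsUnit (popDeriv v δ μ X Y β)) : (popBread v δ μ X Y β).PosDef := by
  rw [h.popBread_posSemidef.posDef_iff_isUnit, ← isUnit_toEuclideanCLM_iff,
    toEuclideanCLM_popBread h.integrable_gradDeriv]
  exact hU

end IsRegular

/-- Shift of the index that multiplies `1 - weight` by `τ`. -/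
noncomputable def shift : Form → ℝ → ℝ
  | .MP, τ => -Real.log τ
  | .AP, τ => Real.log τ

theorem one_sub_weight_shift (y z : ℝ) {τ : ℝ} (hτ : 0 < τ) :
    1 - weight v δ y (z + shift v τ) = τ * (1 - weight v δ y z) := by
  cases v <;> simp only [weight, shift, sub_sub_cancel]
  · rw [neg_add, neg_neg, Real.exp_add, Real.exp_log hτ]; ring
  · rw [Real.exp_add, Real.exp_log hτ]; ring

theorem popDeriv_shift {k₀ : Fin K} (hconst : ∀ ω, X ω k₀ = 1) {τ : ℝ} (hτ : 0 < τ) (φ : Vec K) :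
    popDeriv v δ μ X Y (φ + shift v τ • EuclideanSpace.single k₀ 1) =
      τ • popDeriv v δ μ X Y φ := by
  rw [popDeriv, popDeriv, ← integral_smul]
  congr 1 with ω : 1
  simp only [gradDeriv, inner_add_right, inner_smul_right, inner_single_one, hconst, mul_one,
    one_sub_weight_shift _ _ hτ, mul_smul]

/-- With `u = L (a - B a)` and `w = h • L (B a)`, both `u + w` and `u - w` have norm at most `κ‖L
a‖`. The parallelogram law gives `‖u‖² + ‖w‖² ≤ κ²‖L a‖²`, and `w` is not small because `‖L (B a)‖ ≥
(1 - κ)‖L a‖`. -/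
theorem norm_sub_le_of_scaled {h : ℝ} (hh : 0 ≤ h) {B : Vec K →L[ℝ] Vec K}
    {a : Vec K} (hκ1 : κ ≤ 1) (h0 : ‖L (a - B a)‖ ≤ κ * ‖L a‖)
    (hp : ‖L (a - (1 + h) • B a)‖ ≤ κ * ‖L a‖) (hm : ‖L (a - (1 - h) • B a)‖ ≤ κ * ‖L a‖) :
    ‖L (a - B a)‖ ≤ Real.sqrt (κ ^ 2 - (h * (1 - κ)) ^ 2) * ‖L a‖ := by
  set u := L (a - B a) with hu
  set w := h • L (B a) with hw
  have e1 : L (a - (1 + h) • B a) = u - w := by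
    simp only [hu, hw, map_sub, map_smul, add_smul, one_smul, map_add]; abel
  have e2 : L (a - (1 - h) • B a) = u + w := by
    simp only [hu, hw, map_sub, map_smul, sub_smul, one_smul]; abel
  rw [e1] at hp
  rw [e2] at hm
  have hpar := parallelogram_law_with_norm ℝ u w
  have hBa : (1 - κ) * ‖L a‖ ≤ ‖L (B a)‖ := by
    have h1 : L a = u + L (B a) := by simp [hu]
    have h2 : ‖L a‖ ≤ ‖u‖ + ‖L (B a)‖ := by
      conv_lhs => rw [h1]
      exact norm_add_le _ _
    linarith
  have hwn : ‖w‖ = h * ‖L (B a)‖ := by rw [hw, norm_smul, Real.norm_of_nonneg hh]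
  have hw1 : h * ((1 - κ) * ‖L a‖) ≤ ‖w‖ := by rw [hwn]; gcongr
  have hw2 : (h * ((1 - κ) * ‖L a‖)) ^ 2 ≤ ‖w‖ ^ 2 := by
    have : 0 ≤ h * ((1 - κ) * ‖L a‖) :=
      mul_nonneg hh (mul_nonneg (by linarith) (norm_nonneg _))
    gcongr
  have hp2 : ‖u - w‖ ^ 2 ≤ (κ * ‖L a‖) ^ 2 := by gcongr
  have hm2 : ‖u + w‖ ^ 2 ≤ (κ * ‖L a‖) ^ 2 := by gcongr
  have hsq : ‖u‖ ^ 2 ≤ (κ ^ 2 - (h * (1 - κ)) ^ 2) * ‖L a‖ ^ 2 := by nlinarith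
  calc ‖u‖ = Real.sqrt (‖u‖ ^ 2) := (Real.sqrt_sq (norm_nonneg _)).symm
    _ ≤ Real.sqrt ((κ ^ 2 - (h * (1 - κ)) ^ 2) * ‖L a‖ ^ 2) := Real.sqrt_le_sqrt hsq
    _ = _ := by rw [Real.sqrt_mul' _ (sq_nonneg _), Real.sqrt_sq (norm_nonneg _)]

/-- Since the covariates contain a constant, the derivative at `β` has norm strictly below any
modulus of contraction on a ball around `β`. -/
theorem IsRegular.exists_lt_modulus (hreg : IsRegular v δ μ X Y β L r) {k₀ : Fin K}
    (hconst : ∀ ω, X ω k₀ = 1) (hκ0 : 0 < κ) (hκ1 : κ < 1)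
    (hcon : IsContractionOn L κ (popMap v δ μ X Y) (ball L β r)) :
    ∃ κ₁, 0 ≤ κ₁ ∧ κ₁ < κ ∧ ∀ a, ‖L (popMapDeriv v δ μ X Y β a)‖ ≤ κ₁ * ‖L a‖ := by
  have hder : ∀ φ, ball L β r ∈ 𝓝 φ → ∀ a, ‖L (popMapDeriv v δ μ X Y φ a)‖ ≤ κ * ‖L a‖ :=
    fun φ hφ a => hreg.isC1Limit_popMap.norm_deriv_le hreg.continuousOn_popMapDeriv hκ0.le hcon hφ a
  set B := (Ring.inverse (popOuter μ X)).comp (popDeriv v δ μ X Y β) with hB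
  -- The curve moves only the intercept; along it the derivative of `M` is `I - τB`, and it stays
  -- inside the ball for `τ` near `1`.
  set γ : ℝ → Vec K := fun τ => β + shift v τ • EuclideanSpace.single k₀ 1 with hγ
  have hγc : ContinuousAt γ 1 := by
    have : ContinuousAt (shift v) 1 := by
      cases v
      · exact (Real.continuousAt_log one_ne_zero).neg
      · exact Real.continuousAt_log one_ne_zero
    exact continuousAt_const.add (this.smul continuousAt_const)
  have hγ1 : γ 1 = β := by cases v <;> simp [hγ, shift]
  have hev : ∀ᶠ τ in 𝓝 (1 : ℝ), ball L β r ∈ 𝓝 (γ τ) := by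
    have := eventually_eventually_nhds.2 (ball_mem_nhds L β hreg.r_pos : ∀ᶠ x in 𝓝 β, x ∈ ball L β r)
    exact hγc.eventually (by rw [hγ1]; exact this)
  obtain ⟨ρ, hρ, hball⟩ := Metric.eventually_nhds_iff.1 hev
  -- The cap `1 / 2` keeps `1 - h` positive, as `shift` takes the logarithm of `τ`.
  set h := min (ρ / 2) (1 / 2) with hh
  have hh0 : 0 < h := lt_min (by positivity) (by norm_num)
  have hhρ : h < ρ := (min_le_left _ _).trans_lt (by linarith)
  have hh1 : h < 1 := (min_le_right _ _).trans_lt (by norm_num)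
  have hscaled : ∀ τ, 0 < τ → |τ - 1| < ρ → ∀ a, ‖L (a - τ • B a)‖ ≤ κ * ‖L a‖ := by
    intro τ hτ hτρ a
    have h1 := hder (γ τ) (hball (by rwa [Real.dist_eq])) a
    rw [popMapDeriv, hγ, popDeriv_shift hconst hτ] at h1
    simpa [hB] using h1
  refine ⟨Real.sqrt (κ ^ 2 - (h * (1 - κ)) ^ 2), Real.sqrt_nonneg _, ?_, fun a => ?_⟩
  · rw [Real.sqrt_lt' hκ0]
    have : 0 < h * (1 - κ) := mul_pos hh0 (by linarith)
    nlinarith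
  · have h0 := hder β (ball_mem_nhds L β hreg.r_pos) a
    have e : popMapDeriv v δ μ X Y β a = a - B a := by simp [popMapDeriv, hB]
    rw [e] at h0 ⊢
    exact norm_sub_le_of_scaled hh0.le hκ1.le h0
      (hscaled _ (by linarith) (by rw [add_sub_cancel_left, abs_of_pos hh0]; exact hhρ) a)
      (hscaled _ (by linarith) (by
        rw [show 1 - h - 1 = -h by ring, abs_neg, abs_of_pos hh0]; exact hhρ) a)

-- Any factor `N` with `M = N* N` serves as a square root, so `B` is determined only up to an
-- orthogonal factor on the left.
open scoped MatrixOrder Matrix.Norms.L2Operator in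
theorem exists_sqrt_of_posDef {M : Matrix (Fin K) (Fin K) ℝ} (hM : M.PosDef) :
    ∃ B : Vec K ≃L[ℝ] Vec K, ∀ a c,
      inner ℝ (B a) (B c) = inner ℝ a (Matrix.toEuclideanCLM (𝕜 := ℝ) M c) := by
  obtain ⟨N, hN⟩ := CStarAlgebra.nonneg_iff_eq_star_mul_self.mp hM.posSemidef.nonneg
  have hNu : IsUnit N := by
    have h1 := hM.isUnit
    rw [Matrix.isUnit_iff_isUnit_det] at h1 ⊢
    rw [hN, Matrix.det_mul] at h1
    exact isUnit_of_mul_isUnit_right h1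
  obtain ⟨u, hu⟩ := isUnit_toEuclideanCLM_iff.2 hNu
  refine ⟨ContinuousLinearEquiv.unitsEquiv ℝ (Vec K) u, fun a c => ?_⟩
  rw [ContinuousLinearEquiv.unitsEquiv_apply, ContinuousLinearEquiv.unitsEquiv_apply, hu, hN,
    map_mul, map_star, ContinuousLinearMap.star_eq_adjoint]
  exact (ContinuousLinearMap.adjoint_inner_right _ _ _).symm

theorem integrable_inner_mul_inner (hX2 : MemLp X 2 μ) (a c : Vec K) :
    Integrable (fun ω => inner ℝ (X ω) a * inner ℝ (X ω) c) μ := by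
  have ha : MemLp (fun ω => inner ℝ (X ω) a) 2 μ := by
    simpa only [real_inner_comm] using hX2.const_inner (𝕜 := ℝ) a
  have hc : MemLp (fun ω => inner ℝ (X ω) c) 2 μ := by
    simpa only [real_inner_comm] using hX2.const_inner (𝕜 := ℝ) c
  exact ha.integrable_mul hc

/-- In the norm of `L'` the derivative is `Q⁻¹(Q - D)`, and `Q - D` is the form `E[w X X']`. This
form lies between `0` and `κ₁ Q` because `D` dominates a positive multiple of `Q`. -/
theorem IsRegular.norm_popMapDeriv_le (h : IsRegular v δ μ X Y β L r)
    (hw : ∀ᵐ ω ∂μ, 0 ≤ weight v δ (Y ω) (inner ℝ (X ω) β))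
    (hA : (popBread v δ μ X Y β).PosDef) {L' : Vec K ≃L[ℝ] Vec K}
    (hL' : ∀ a c, inner ℝ (L' a) (L' c) = inner ℝ a (popOuter μ X c)) :
    ∃ κ₁, 0 ≤ κ₁ ∧ κ₁ < 1 ∧ ∀ a, ‖L' (popMapDeriv v δ μ X Y β a)‖ ≤ κ₁ * ‖L' a‖ := by
  set Q := popOuter μ X
  set D := popDeriv v δ μ X Y β
  obtain ⟨B, hB⟩ := exists_sqrt_of_posDef hA
  rw [toEuclideanCLM_popBread h.integrable_gradDeriv] at hB
  -- the weighted form `a, c ↦ E[w (X'a)(X'c)]`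
  have hint : ∀ a c, Integrable (fun ω => (1 - weight v δ (Y ω) (inner ℝ (X ω) β)) *
      (inner ℝ (X ω) a * inner ℝ (X ω) c)) μ := by
    intro a c
    have := (h.integrable_gradDeriv.apply_continuousLinearMap a).const_inner (𝕜 := ℝ) c
    refine this.congr (Eventually.of_forall fun ω => ?_)
    simp only [gradDeriv_apply, inner_smul_right, real_inner_comm]
    ring
  have hform : ∀ a c, inner ℝ c (Q a - D a) =
      ∫ ω, weight v δ (Y ω) (inner ℝ (X ω) β) * (inner ℝ (X ω) a * inner ℝ (X ω) c) ∂μ := by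
    intro a c
    rw [inner_sub_right, inner_popOuter h.measurable_X h.memLp,
      inner_popDeriv h.integrable_gradDeriv,
      ← integral_sub (integrable_inner_mul_inner h.memLp a c) (hint a c)]
    congr 1 with ω
    ring
  let W : LinearMap.BilinForm ℝ (Vec K) :=
    (innerₗ (Vec K)).compl₂ ((Q - D : Vec K →L[ℝ] Vec K) : Vec K →ₗ[ℝ] Vec K)
  have hWa : ∀ a c, W c a = inner ℝ c (Q a - D a) := fun a c => rfl
  have hWnn : ∀ a, 0 ≤ W a a := by
    intro a
    rw [hWa, hform]
    refine integral_nonneg_of_ae ?_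
    filter_upwards [hw] with ω hω
    exact mul_nonneg hω (mul_self_nonneg _)
  have hWs : ∀ a c, W a c = W c a := by
    intro a c
    rw [hWa, hWa, hform, hform]
    congr 1 with ω
    ring
  have hnorm : ∀ a, inner ℝ a (Q a) = ‖L' a‖ ^ 2 := fun a => by
    rw [← hL', real_inner_self_eq_norm_sq]
  have hnormB : ∀ a, inner ℝ a (D a) = ‖B a‖ ^ 2 := fun a => by
    rw [← hB, real_inner_self_eq_norm_sq]
  -- Comparison constant of the two norms, `Q ≤ k D`. The added `1` ensures `k ≥ 1`, so that `κ₁ = 1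
  -- - k⁻¹` lies in `[0, 1)`.
  set k := (‖(L' : Vec K →L[ℝ] Vec K)‖ * ‖(B.symm : Vec K →L[ℝ] Vec K)‖) ^ 2 + 1 with hk
  have hk1 : 1 ≤ k := by rw [hk]; nlinarith [sq_nonneg (‖(L' : Vec K →L[ℝ] Vec K)‖ *
    ‖(B.symm : Vec K →L[ℝ] Vec K)‖)]
  have hLB : ∀ a, ‖L' a‖ ^ 2 ≤ k * ‖B a‖ ^ 2 := by
    intro a
    have h1 : ‖L' a‖ ≤ ‖(L' : Vec K →L[ℝ] Vec K)‖ * (‖(B.symm : Vec K →L[ℝ] Vec K)‖ * ‖B a‖) :=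
      (norm_le_mul L' a).trans (by gcongr; exact norm_le_symm_mul B a)
    have h2 : ‖L' a‖ ^ 2 ≤ (‖(L' : Vec K →L[ℝ] Vec K)‖ *
        (‖(B.symm : Vec K →L[ℝ] Vec K)‖ * ‖B a‖)) ^ 2 := by gcongr
    rw [hk]
    nlinarith [sq_nonneg ‖B a‖]
  set κ₁ := 1 - k⁻¹ with hκ₁
  have hkinv : k⁻¹ ≤ 1 := inv_le_one_of_one_le₀ hk1
  have hkpos : 0 < k⁻¹ := by positivity
  have hWle : ∀ a, W a a ≤ κ₁ * ‖L' a‖ ^ 2 := by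
    intro a
    rw [hWa, inner_sub_right, hnorm, hnormB, hκ₁]
    have := hLB a
    have h2 : k⁻¹ * ‖L' a‖ ^ 2 ≤ ‖B a‖ ^ 2 := by
      rw [inv_mul_le_iff₀ (by positivity)]; exact this
    linarith
  refine ⟨κ₁, by linarith, by linarith, fun a => ?_⟩
  set c := popMapDeriv v δ μ X Y β a with hc
  have hQc : Q c = Q a - D a := by
    rw [hc, popMapDeriv]
    simp only [sub_apply, ContinuousLinearMap.comp_apply, ContinuousLinearMap.id_apply, map_sub]
    rw [apply_inverse_apply h.isUnit_popOuter]
  have hcc : W c a = ‖L' c‖ ^ 2 := by rw [hWa, ← hQc, hnorm]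
  -- Cauchy–Schwarz for the form `W`: since `Q c = (Q - D) a`, the mixed term `W c a` is `‖L' c‖²`.
  have hCS := W.apply_mul_apply_le_of_forall_zero_le hWnn c a
  rw [hWs a c, hcc] at hCS
  have h1 : ‖L' c‖ ^ 2 * ‖L' c‖ ^ 2 ≤ (κ₁ * ‖L' c‖ ^ 2) * (κ₁ * ‖L' a‖ ^ 2) :=
    hCS.trans (mul_le_mul (hWle c) (hWle a) (hWnn a) ((hWnn c).trans (hWle c)))
  rcases eq_or_ne ‖L' c‖ 0 with h0 | h0
  · rw [h0]; exact mul_nonneg (by linarith) (norm_nonneg _)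
  · have hpos : 0 < ‖L' c‖ ^ 2 := by positivity
    have h2 : ‖L' c‖ ^ 2 ≤ (κ₁ * ‖L' a‖) ^ 2 := by nlinarith
    exact (sq_le_sq₀ (norm_nonneg _) (mul_nonneg (by linarith) (norm_nonneg _))).1 h2

/-- Weights between `0` and `1` suffice for a contraction near `β` in the norm of prewhitened
covariates. -/
theorem IsRegular.exists_contraction (h : IsRegular v δ μ X Y β L r)
    (hw : ∀ᵐ ω ∂μ, 0 ≤ weight v δ (Y ω) (inner ℝ (X ω) β))
    (hA : (popBread v δ μ X Y β).PosDef) :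
    ∃ (L' : Vec K ≃L[ℝ] Vec K) (r' κ : ℝ), 0 < r' ∧ 0 < κ ∧ κ < 1 ∧
      (∀ a, ‖L' a‖ ^ 2 = ∫ ω, (inner ℝ (X ω) a) ^ 2 ∂μ) ∧
      ball L' β r' ⊆ ball L β r ∧
      IsContractionOn L' κ (popMap v δ μ X Y) (ball L' β r') := by
  obtain ⟨L', hL'⟩ := exists_sqrt_of_posDef h.posDef
  rw [toEuclideanCLM_secondMoment h.measurable_X h.memLp] at hL'
  obtain ⟨κ₁, hκ₁0, hκ₁1, hd⟩ := h.norm_popMapDeriv_le hw hA hL'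
  obtain ⟨ρ, hρ, hsub⟩ := exists_ball_subset L' β (ball_mem_nhds L β h.r_pos)
  obtain ⟨r₁, hr₁, hr₁ρ, η, hη, hloc⟩ := exists_local_contraction L' β hρ
    (κ₁ := κ₁) (q := (κ₁ + 1) / 2) (by linarith) (h.continuousOn_popMapDeriv.mono hsub) hd
  refine ⟨L', r₁, (κ₁ + 1) / 2, hr₁, by linarith, by linarith, fun a => ?_,
    (ball_mono L' β hr₁ρ).trans hsub,
    hloc (popMap v δ μ X Y) (popMapDeriv v δ μ X Y) ?_ fun x _ => by simpa using hη.le⟩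
  · rw [← real_inner_self_eq_norm_sq, hL', inner_popOuter h.measurable_X h.memLp]
    simp only [sq]
  · intro ε hε
    obtain ⟨F, F', hF⟩ := h.isC1Limit_popMap ε hε
    exact ⟨F, F', fun x hx => hF x (hsub hx)⟩

end Contraction

/-! ### The sandwich covariance and the limit law of the influence function -/

section Covariance

variable {Ω : Type*} [MeasurableSpace Ω] {K : ℕ} {μ : Measure Ω} {v : Form} {δ : ℝ}
  {β : Vec K} {L : Vec K ≃L[ℝ] Vec K} {r κ : ℝ}

theorem memLp_coord {Z : Ω → Vec K} (hZ : MemLp Z 2 μ) (k : Fin K) :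
    MemLp (fun ω => Z ω k) 2 μ := by
  have := hZ.const_inner (𝕜 := ℝ) (EuclideanSpace.single k 1)
  simpa [EuclideanSpace.inner_single_left] using this

theorem variance_inner_eq [IsProbabilityMeasure μ] {Z : Ω → Vec K} (hZ : MemLp Z 2 μ)
    (a : Vec K) : Var[fun ω => inner ℝ a (Z ω); μ] =
      a.ofLp ⬝ᵥ (Matrix.of fun k l =>
        covariance (fun ω => Z ω k) (fun ω => Z ω l) μ).mulVec a.ofLp := by
  have h1 : (fun ω => inner ℝ a (Z ω)) = fun ω => ∑ k, a k * Z ω k := by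
    ext1 ω
    simp [PiLp.inner_apply, mul_comm]
  have hm : ∀ k, MemLp (fun ω => a k * Z ω k) 2 μ := fun k => (memLp_coord hZ k).const_mul _
  rw [h1, ← covariance_self, covariance_fun_sum_fun_sum hm hm]
  · simp only [dotProduct, Matrix.mulVec, Matrix.of_apply, Finset.mul_sum]
    refine Finset.sum_congr rfl fun k _ => Finset.sum_congr rfl fun l _ => ?_
    rw [covariance_const_mul_left, covariance_const_mul_right]
    ring
  · exact (memLp_finsetSum _ fun k _ => hm k).aestronglyMeasurable.aemeasurable

theorem inner_inverse_popDeriv {X : Ω → Vec K} {Y : Ω → ℝ}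
    (h : Integrable (fun ω => gradDeriv v δ (X ω) (Y ω) β) μ)
    (hU : IsUnit (popDeriv v δ μ X Y β)) (a b : Vec K) :
    inner ℝ a (Ring.inverse (popDeriv v δ μ X Y β) b) =
      inner ℝ (Ring.inverse (popDeriv v δ μ X Y β) a) b := by
  set D := popDeriv v δ μ X Y β
  have hsymm : ∀ x y, inner ℝ (D x) y = inner ℝ x (D y) := by
    intro x y
    rw [real_inner_comm, inner_popDeriv h, inner_popDeriv h]
    congr 1 with ω
    ring
  conv_lhs => rw [← apply_inverse_apply hU a]
  rw [hsymm, apply_inverse_apply hU]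

/-- The inverse of `popDeriv` is symmetric, so it moves across the inner product onto `a`; what
remains is the variance of a projection of the score. -/
theorem asympCov_quadratic [IsProbabilityMeasure μ] {X : Ω → Vec K} {Y : Ω → ℝ}
    (h : IsRegular v δ μ X Y β L r) (hU : IsUnit (popDeriv v δ μ X Y β))
    (hscore : MemLp (score v δ X Y β) 2 μ) (a : Vec K) :
    Var[fun ω => inner ℝ a (Ring.inverse (popDeriv v δ μ X Y β) (score v δ X Y β ω)); μ] =
      a.ofLp ⬝ᵥ (asympCov v δ μ X Y β).mulVec a.ofLp := by
  have hA : IsUnit (popBread v δ μ X Y β) := by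
    rw [← isUnit_toEuclideanCLM_iff, toEuclideanCLM_popBread h.integrable_gradDeriv]; exact hU
  simp only [inner_inverse_popDeriv h.integrable_gradDeriv hU]
  rw [variance_inner_eq hscore, ← Matrix.inner_toEuclideanCLM, ← Matrix.inner_toEuclideanCLM,
    asympCov, sandwich, map_mul, map_mul, toEuclideanCLM_inv hA,
    toEuclideanCLM_popBread h.integrable_gradDeriv]
  exact (inner_inverse_popDeriv h.integrable_gradDeriv hU _ _).symm

theorem scoreCov_transpose (X : Ω → Vec K) (Y : Ω → ℝ) :
    (scoreCov v δ μ X Y β).transpose = scoreCov v δ μ X Y β := by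
  ext k l
  simp only [scoreCov, Matrix.transpose_apply, Matrix.of_apply]
  exact covariance_comm _ _

theorem asympCov_posSemidef [IsProbabilityMeasure μ] {X : Ω → Vec K} {Y : Ω → ℝ}
    (h : IsRegular v δ μ X Y β L r) (hU : IsUnit (popDeriv v δ μ X Y β))
    (hscore : MemLp (score v δ X Y β) 2 μ) : (asympCov v δ μ X Y β).PosSemidef := by
  refine .of_dotProduct_mulVec_nonneg ?_ fun a => ?_
  · have h1 : (popBread v δ μ X Y β).transpose = popBread v δ μ X Y β := by
      have := h.popBread_posSemidef.1
      rwa [Matrix.IsHermitian, Matrix.conjTranspose_eq_transpose_of_trivial] at this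
    rw [Matrix.IsHermitian, Matrix.conjTranspose_eq_transpose_of_trivial, asympCov, sandwich,
      Matrix.transpose_mul, Matrix.transpose_mul, Matrix.transpose_nonsing_inv, h1,
      scoreCov_transpose, Matrix.mul_assoc]
  · rw [star_trivial, ← asympCov_quadratic h hU hscore (WithLp.toLp 2 a)]
    exact variance_nonneg _ _

/-- Asymptotic normality of the averaged influence function. -/
theorem IsSampling.tendstoInDistribution [IsProbabilityMeasure μ] {X : ℕ → Ω → Vec K}
    {Y : ℕ → Ω → ℝ} (hs : IsSampling μ X Y) (h : IsRegular v δ μ (X 0) (Y 0) β L r)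
    (hU : IsUnit (popDeriv v δ μ (X 0) (Y 0) β))
    (hscore : MemLp (score v δ (X 0) (Y 0) β) 2 μ) :
    TendstoInDistribution (fun (n : ℕ) ω => √(n : ℝ) •
        Ring.inverse (popDeriv v δ μ (X 0) (Y 0) β) (-avgGrad v δ X Y (n, ω) β)) atTop id
      (fun _ => μ) (multivariateGaussian 0 (asympCov v δ μ (X 0) (Y 0) β)) := by
  set D := popDeriv v δ μ (X 0) (Y 0) β
  set Ψ : Vec K × ℝ → Vec K := fun p => Ring.inverse D (-grad v δ p.1 p.2 β) with hΨ
  have hΨc : Continuous Ψ := (Ring.inverse D).continuous.comp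
    (continuous_grad v δ continuous_fst continuous_snd continuous_const).neg
  have hΨs : ∀ i, (fun ω => Ψ (X i ω, Y i ω)) =
      fun ω => Ring.inverse D (score v δ (X i) (Y i) β ω) := by
    intro i
    ext1 ω
    simp [hΨ, grad, score]
  have hclt := tendstoInDistribution_multivariate (μ := μ) (ψ := fun i ω => Ψ (X i ω, Y i ω))
    (asympCov_posSemidef h hU hscore)
    (by rw [hΨs]; exact (Ring.inverse D).comp_memLp' hscore)
    (by
      have h0 := h.popGrad_self
      rw [popGrad] at h0
      have h1 : Integrable (fun ω => grad v δ (X 0 ω) (Y 0 ω) β) μ := by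
        refine (h.score.neg).congr (Eventually.of_forall fun ω => ?_)
        simp [grad, score]
      simp only [hΨ, map_neg]
      rw [integral_neg, (Ring.inverse D).integral_comp_comm h1, h0, map_zero, neg_zero])
    (fun a => by
      rw [← asympCov_quadratic h hU hscore a]
      congr 1
      ext1 ω
      rw [show Ψ (X 0 ω, Y 0 ω) = _ from congrFun (hΨs 0) ω])
    (hs.indep.comp (fun _ => Ψ) fun _ => hΨc.measurable)
    (fun i => (hs.ident i).comp hΨc.measurable)
  have hsum : (fun (n : ℕ) ω => √(n : ℝ) • Ring.inverse D (-avgGrad v δ X Y (n, ω) β)) =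
      fun (n : ℕ) ω => (√(n : ℝ))⁻¹ • ∑ i : Fin n, Ψ (X i ω, Y i ω) := by
    funext n ω
    simp only [avgGrad, hΨ, ← smul_neg, ← Finset.sum_neg_distrib, map_smul, map_sum, smul_smul]
    congr 1
    rcases eq_or_ne n 0 with rfl | hn
    · simp
    · have : 0 < √(n : ℝ) := by positivity
      have h2 := Real.mul_self_sqrt (Nat.cast_nonneg (α := ℝ) n)
      field_simp
      rw [sq, h2]
  rw [hsum]
  exact hclt

end Covariance

/-! ### Measurability of the iterates -/

section Measurability

variable {Ω : Type*} [MeasurableSpace Ω] {K : ℕ} {μ : Measure Ω}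

theorem aemeasurable_matrix_inv {A : Ω → Matrix (Fin K) (Fin K) ℝ}
    (hA : ∀ k l, AEMeasurable (fun ω => A ω k l) μ) (k l : Fin K) :
    AEMeasurable (fun ω => (A ω)⁻¹ k l) μ := by
  have hdet : ∀ {B : Ω → Matrix (Fin K) (Fin K) ℝ}, (∀ k l, AEMeasurable (fun ω => B ω k l) μ) →
      AEMeasurable (fun ω => (B ω).det) μ := by
    intro B hB
    simp only [Matrix.det_apply]
    exact Finset.aemeasurable_fun_sum _ fun σ _ =>
      (Finset.aemeasurable_fun_prod _ fun i _ => hB _ _).const_smul _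
  simp only [Matrix.inv_def, Ring.inverse_eq_inv', Matrix.smul_apply, Matrix.adjugate_apply,
    smul_eq_mul]
  refine (hdet hA).inv.mul (hdet fun i j => ?_)
  simp only [Matrix.updateRow_apply]
  split_ifs
  · exact aemeasurable_const
  · exact hA i j

theorem measurable_transformed (v : Form) (δ : ℝ) :
    Measurable fun q : ℝ × ℝ => transformed v δ q.1 q.2 := by
  have he : Measurable fun q : ℝ × ℝ => err v q.1 q.2 := by
    cases v <;> simp only [err] <;> fun_prop
  unfold transformed correction
  exact (Real.measurable_log.comp (by fun_prop)).sub
    ((Real.measurable_log.comp (by fun_prop)).sub (he.const_mul _))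

theorem aemeasurable_step (v : Form) (δ : ℝ) {n : ℕ} {x : Fin n → Ω → Vec K} {y : Fin n → Ω → ℝ}
    (hx : ∀ i, Measurable (x i)) (hy : ∀ i, Measurable (y i)) {b : Ω → Vec K}
    (hb : AEMeasurable b μ) :
    AEMeasurable (fun ω => step v δ (fun i => x i ω) (fun i => y i ω) (b ω)) μ := by
  have hxk : ∀ i k, AEMeasurable (fun ω => x i ω k) μ := fun i k =>
    ((EuclideanSpace.proj (𝕜 := ℝ) k).continuous.measurable.comp (hx i)).aemeasurable
  have hz : ∀ i, AEMeasurable (fun ω => transformed v δ (y i ω) (inner ℝ (x i ω) (b ω))) μ :=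
    fun i => (measurable_transformed v δ).comp_aemeasurable
      ((hy i).aemeasurable.prodMk ((hx i).aemeasurable.inner hb))
  refine (WithLp.measurable_toLp 2 (Fin K → ℝ)).comp_aemeasurable
    (aemeasurable_pi_lambda _ fun k => ?_)
  simp only [Matrix.mulVec, dotProduct, design, Matrix.transpose_apply, Matrix.of_apply]
  refine Finset.aemeasurable_fun_sum _ fun l _ => AEMeasurable.mul ?_ ?_
  · refine aemeasurable_matrix_inv (fun k l => ?_) _ _
    simp only [Matrix.mul_apply, Matrix.transpose_apply, Matrix.of_apply]
    exact Finset.aemeasurable_fun_sum _ fun i _ => (hxk i k).mul (hxk i l)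
  · exact Finset.aemeasurable_fun_sum _ fun i _ => (hxk i l).mul (hz i)

/-- Convergence in distribution requires measurable iterates. The roots to which they are compared
are chosen pointwise and need not be measurable. -/
theorem aemeasurable_iter (v : Form) (δ : ℝ) {n : ℕ} {x : Fin n → Ω → Vec K} {y : Fin n → Ω → ℝ}
    (hx : ∀ i, Measurable (x i)) (hy : ∀ i, Measurable (y i)) {b : Ω → Vec K}
    (hb : AEMeasurable b μ) (t : ℕ) :
    AEMeasurable (fun ω => iter v δ (fun i => x i ω) (fun i => y i ω) (b ω) t) μ := by
  induction t with
  | zero => exact hb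
  | succ t ih =>
    simp only [iter, Function.iterate_succ_apply']
    exact aemeasurable_step v δ hx hy ih

end Measurability

/-- The lower bound on `t n` gives the rate `n ^ (-(log q / log κ - 1) / 2)`, whose exponent is
negative precisely because `q < κ`; with `q = κ` it would be bounded only. -/
theorem tendsto_sqrt_mul_pow {q κ : ℝ} (hq : 0 < q) (hqκ : q < κ) (hκ1 : κ < 1) {t : ℕ → ℕ}
    (ht : ∀ n : ℕ, -(1 / 2) * Real.log (n : ℝ) / Real.log κ ≤ (t n : ℝ)) :
    Tendsto (fun n : ℕ => √(n : ℝ) * q ^ t n) atTop (𝓝 0) := by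
  have hκ : 0 < κ := hq.trans hqκ
  have hlκ : Real.log κ < 0 := Real.log_neg hκ hκ1
  have hlq : Real.log q < Real.log κ := Real.log_lt_log hq hqκ
  have hρ : 0 < (Real.log q / Real.log κ - 1) / 2 := by
    have : 1 < Real.log q / Real.log κ := by rw [one_lt_div_of_neg hlκ]; exact hlq
    linarith
  have h1 := (tendsto_rpow_neg_atTop hρ).comp tendsto_natCast_atTop_atTop
  refine squeeze_zero' (Eventually.of_forall fun n => by positivity) ?_ h1
  filter_upwards [eventually_gt_atTop 0] with n hn
  have hn' : (0 : ℝ) < n := by exact_mod_cast hn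
  have h2 : q ^ t n ≤ Real.exp (-(1 / 2) * Real.log n / Real.log κ * Real.log q) := by
    rw [← Real.rpow_natCast, Real.rpow_def_of_pos hq, mul_comm (Real.log q)]
    exact Real.exp_le_exp.2 (mul_le_mul_of_nonpos_right (ht n) (hlq.trans hlκ).le)
  calc √(n : ℝ) * q ^ t n
      ≤ Real.exp (Real.log n * (1 / 2)) *
        Real.exp (-(1 / 2) * Real.log n / Real.log κ * Real.log q) := by
        rw [Real.sqrt_eq_rpow, Real.rpow_def_of_pos hn']
        gcongr
    _ = _ := by
        rw [← Real.exp_add, Function.comp_apply, Real.rpow_def_of_pos hn']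
        congr 1
        field_simp
        ring

/-- A convergent operator applied to a uniformly convergent, bounded family converges uniformly. It
combines the inverse Gram average with the averaged gradient and its derivative. -/
theorem eventually_forall_norm_map_sub_le {α ι E F : Type*} [NormedAddCommGroup E]
    [NormedSpace ℝ E] [NormedAddCommGroup F] [NormedSpace ℝ F] {l : Filter α} {S : Set ι}
    {T : α → E →L[ℝ] F} {T₀ : E →L[ℝ] F} (hT : Tendsto T l (𝓝 T₀)) {a : α → ι → E} {a₀ : ι → E}
    {C : ℝ} (hb : ∀ x ∈ S, ‖a₀ x‖ ≤ C)
    (ha : ∀ ε > 0, ∀ᶠ p in l, ∀ x ∈ S, ‖a p x - a₀ x‖ ≤ ε) {ε : ℝ} (hε : 0 < ε) :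
    ∀ᶠ p in l, ∀ x ∈ S, ‖T p (a p x) - T₀ (a₀ x)‖ ≤ ε := by
  set ε₁ := ε / 2 / (‖T₀‖ + 1) with hε₁
  set ε₂ := ε / 2 / (|C| + 1) with hε₂
  have h1 : ∀ᶠ p in l, ‖T p‖ < ‖T₀‖ + 1 :=
    hT.norm.eventually (gt_mem_nhds (by linarith))
  have h2 : ∀ᶠ p in l, ‖T p - T₀‖ < ε₂ := by
    simpa only [dist_eq_norm] using Metric.tendsto_nhds.1 hT ε₂ (by positivity)
  filter_upwards [h1, h2, ha ε₁ (by positivity)] with p hp1 hp2 hp3 x hx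
  have e : T p (a p x) - T₀ (a₀ x) = T p (a p x - a₀ x) + (T p - T₀) (a₀ x) := by simp
  have h3 : ‖T p (a p x - a₀ x)‖ ≤ (‖T₀‖ + 1) * ε₁ :=
    (T p).le_of_opNorm_le_of_le hp1.le (hp3 x hx)
  have h4 : ‖(T p - T₀) (a₀ x)‖ ≤ ε₂ * (|C| + 1) :=
    (T p - T₀).le_of_opNorm_le_of_le hp2.le ((hb x hx).trans (by linarith [le_abs_self C]))
  have h5 : (‖T₀‖ + 1) * ε₁ = ε / 2 := by rw [hε₁]; field_simp
  have h6 : ε₂ * (|C| + 1) = ε / 2 := by rw [hε₂]; field_simp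
  rw [e]
  exact (norm_add_le _ _).trans (by linarith)

theorem sum_grad_eq_zero_iff_avgGrad {Ω : Type*} {K : ℕ} {v : Form} {δ : ℝ} {X : ℕ → Ω → Vec K}
    {Y : ℕ → Ω → ℝ} {p : ℕ × Ω} (hp : p.1 ≠ 0) (b : Vec K) :
    ∑ i : Fin p.1, grad v δ (X i p.2) (Y i p.2) b = 0 ↔ avgGrad v δ X Y p b = 0 := by
  rw [avgGrad, smul_eq_zero_iff_right]
  simpa using hp

/-! ### Behaviour of the sample map with probability tending to one -/

section Asymptotics

variable {Ω : Type*} [MeasurableSpace Ω] {K : ℕ} {μ : Measure Ω} [IsProbabilityMeasure μ]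
  {v : Form} {δ : ℝ} {X : ℕ → Ω → Vec K} {Y : ℕ → Ω → ℝ}
  {β : Vec K} {L : Vec K ≃L[ℝ] Vec K} {r κ : ℝ}

theorem IsSampling.tendsto_inverse_avgOuter (hs : IsSampling μ X Y)
    (h : IsRegular v δ μ (X 0) (Y 0) β L r) :
    Tendsto (fun p => Ring.inverse (avgOuter X p)) (probOne μ)
      (𝓝 (Ring.inverse (popOuter μ (X 0)))) := by
  obtain ⟨u, hu⟩ := h.isUnit_popOuter
  have := NormedRing.inverse_continuousAt u
  rw [hu] at this
  exact this.tendsto.comp (hs.tendsto_avgOuter h.memLp)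

theorem IsSampling.eventually_isUnit_avgOuter (hs : IsSampling μ X Y)
    (h : IsRegular v δ μ (X 0) (Y 0) β L r) : ∀ᶠ p in probOne μ, IsUnit (avgOuter X p) :=
  (hs.tendsto_avgOuter h.memLp).eventually (Units.isOpen.mem_nhds h.isUnit_popOuter)

theorem IsSampling.tendsto_avgDeriv (hs : IsSampling μ X Y)
    (h : IsRegular v δ μ (X 0) (Y 0) β L r) {b : ℕ × Ω → Vec K}
    (hb : Tendsto b (probOne μ) (𝓝 β)) :
    Tendsto (fun p => avgDeriv v δ X Y p (b p)) (probOne μ)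
      (𝓝 (popDeriv v δ μ (X 0) (Y 0) β)) := by
  have hc := (h.continuousOn_popDeriv.continuousAt (ball_mem_nhds L β h.r_pos)).tendsto.comp hb
  refine Metric.tendsto_nhds.2 fun ε hε => ?_
  filter_upwards [Metric.tendsto_nhds.1 hc (ε / 2) (half_pos hε),
    hs.avgDeriv_close h.memLp h.dominated (show 0 < ε / 3 by positivity),
    hb.eventually (ball_mem_nhds L β h.r_pos)] with p h1 h2 h3
  refine (dist_triangle _ (popDeriv v δ μ (X 0) (Y 0) (b p)) _).trans_lt ?_
  have := h2 _ h3
  rw [← dist_eq_norm] at this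
  have h1' : dist (popDeriv v δ μ (X 0) (Y 0) (b p)) (popDeriv v δ μ (X 0) (Y 0) β) < ε / 2 := h1
  linarith

theorem IsSampling.tendsto_avgGrad_self (hs : IsSampling μ X Y)
    (h : IsRegular v δ μ (X 0) (Y 0) β L r) :
    Tendsto (fun p => avgGrad v δ X Y p β) (probOne μ) (𝓝 0) := by
  refine Metric.tendsto_nhds.2 fun ε hε => ?_
  filter_upwards [hs.avgGrad_close h.delta_pos h.r_pos h.memLp h.dominated h.score
    (half_pos hε)] with p hp
  have := hp β h.mem_ball
  rw [h.popGrad_self, ← dist_eq_norm] at this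
  linarith

/-- With probability tending to one, the iterations converge geometrically, uniformly in the
starting point, and at a rate strictly below the modulus of contraction `κ`. -/
theorem IsSampling.exists_rate (hs : IsSampling μ X Y)
    (h : IsRegular v δ μ (X 0) (Y 0) β L r) {κ₁ : ℝ} (hκ₁ : 0 ≤ κ₁) (hκ : κ₁ < κ) (hκ1 : κ < 1)
    (hcon : IsContractionOn L κ (popMap v δ μ (X 0) (Y 0)) (ball L β r))
    (hd : ∀ a, ‖L (popMapDeriv v δ μ (X 0) (Y 0) β a)‖ ≤ κ₁ * ‖L a‖) :
    ∃ q C C', 0 < q ∧ q < κ ∧ ∀ᶠ p in probOne μ, ∃ b,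
      avgGrad v δ X Y p b = 0 ∧ ‖b - β‖ ≤ C' * ‖avgGrad v δ X Y p β‖ ∧
      ∀ b₀ ∈ ball L β r, ∀ t,
        ‖iter v δ (fun i : Fin p.1 => X i p.2) (fun i => Y i p.2) b₀ t - b‖ ≤ C * q ^ t := by
  obtain ⟨q, C, η, hq, hqκ, hC, hη, hmain⟩ := exists_uniform_rate L β h.r_pos hκ₁ hκ hκ1
    h.isC1Limit_popMap h.continuousOn_popMapDeriv h.popMap_self hcon hd
  set R := Ring.inverse (popOuter μ (X 0)) with hR
  have hinv := hs.tendsto_inverse_avgOuter h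
  obtain ⟨g, hg, hle⟩ := exists_dominating_grad h.delta_pos h.r_pos h.memLp h.dominated h.score
  obtain ⟨g', hg', hle'⟩ := exists_dominating_gradDeriv h.memLp h.dominated
  have hfun := eventually_forall_norm_map_sub_le hinv (S := ball L β r)
    (a := avgGrad v δ X Y) (a₀ := popGrad v δ μ (X 0) (Y 0)) (C := ∫ ω, g ω ∂μ)
    (fun φ hφ => norm_integral_le_of_norm_le hg (hle.mono fun ω hω => hω φ hφ))
    (fun ε hε => hs.avgGrad_close h.delta_pos h.r_pos h.memLp h.dominated h.score hε) hη
  -- The operators are now the left compositions with the inverse Gram averages, acting on the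
  -- derivatives.
  have hder := eventually_forall_norm_map_sub_le
    (((ContinuousLinearMap.compL ℝ (Vec K) (Vec K) (Vec K)).continuous.tendsto _).comp hinv)
    (S := ball L β r)
    (a := avgDeriv v δ X Y) (a₀ := popDeriv v δ μ (X 0) (Y 0)) (C := ∫ ω, g' ω ∂μ)
    (fun φ hφ => norm_integral_le_of_norm_le hg' (hle'.mono fun ω hω => hω φ hφ))
    (fun ε hε => hs.avgDeriv_close h.memLp h.dominated hε) hη
  have hbd : ∀ᶠ p in probOne μ, ‖Ring.inverse (avgOuter X p)‖ < ‖R‖ + 1 :=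
    hinv.norm.eventually (gt_mem_nhds (by linarith))
  refine ⟨q, C, C * (‖R‖ + 1), hq, hqκ, ?_⟩
  filter_upwards [hfun, hder, hbd, hs.eventually_isUnit_avgOuter h] with p h1 h2 h3 h4
  set Q := Ring.inverse (avgOuter X p)
  obtain ⟨b, -, hfix, hbβ, hrate⟩ := hmain (fun φ => φ - Q (avgGrad v δ X Y p φ))
    (fun φ => ContinuousLinearMap.id ℝ (Vec K) - Q.comp (avgDeriv v δ X Y p φ))
    ((IsC1Limit.of_hasFDerivAt fun φ _ => hasFDerivAt_id φ).sub
      ((isC1Limit_avgGrad h.delta_pos _ p).clm_comp Q))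
    (fun φ hφ => by
      rw [h.popMap_eq hφ, sub_sub_sub_cancel_left, norm_sub_rev]
      exact h1 φ hφ)
    (fun φ hφ => by
      rw [popMapDeriv, sub_sub_sub_cancel_left, norm_sub_rev]
      exact h2 φ hφ)
  have hstep : step v δ (fun i : Fin p.1 => X i p.2) (fun i => Y i p.2) =
      fun φ => φ - Q (avgGrad v δ X Y p φ) := funext fun φ => step_eq_avg h.delta_pos hs.nonneg h4 φ
  refine ⟨b, ?_, ?_, fun b₀ hb₀ t => ?_⟩
  · have h5 : Q (avgGrad v δ X Y p b) = 0 := by simpa using hfix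
    rw [← apply_inverse_apply h4 (avgGrad v δ X Y p b)]
    rw [show Ring.inverse (avgOuter X p) (avgGrad v δ X Y p b) = 0 from h5, map_zero]
  · refine hbβ.trans ?_
    rw [sub_sub_cancel_left, norm_neg, mul_assoc]
    gcongr
    exact Q.le_of_opNorm_le h3.le _
  · rw [iter, hstep]
    exact hrate b₀ hb₀ t

/-- With probability tending to one, there is at most one Poisson estimate. -/
theorem IsSampling.eventually_unique (hs : IsSampling μ X Y)
    (h : IsRegular v δ μ (X 0) (Y 0) β L r) (hU : IsUnit (popDeriv v δ μ (X 0) (Y 0) β)) :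
    ∀ᶠ p in probOne μ, ∀ b b',
      IsPoissonEstimate v (fun i : Fin p.1 => X i p.2) (fun i => Y i p.2) b →
      IsPoissonEstimate v (fun i : Fin p.1 => X i p.2) (fun i => Y i p.2) b' → b' = b := by
  filter_upwards [(hs.tendsto_avgDeriv h (tendsto_const_nhds (x := β))).eventually
    (Units.isOpen.mem_nhds hU)] with p hp b b' hb hb'
  rw [← sum_grad_eq_zero_iff_isPoissonEstimate h.delta_pos] at hb hb'
  refine eq_of_sum_grad_eq_zero (φ := β) h.delta_pos _ _ (fun i => hs.nonneg i p.2)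
    (fun a ha => ?_) hb hb'
  have h1 : avgDeriv v δ X Y p β a = 0 := by
    rw [avgDeriv, smul_apply, sum_apply, ha, smul_zero]
  rw [← inverse_apply_apply hp a, h1, map_zero]

end Asymptotics

/-- Root-`n` boundedness implies consistency. -/
theorem tendstoInMeasure_of_isBoundedInProb {Ω : Type*} [MeasurableSpace Ω] {K : ℕ} {μ : Measure Ω} {β : Vec K}
    {c : ℕ → Ω → Vec K}
    (hc : IsBoundedInProb μ fun n ω => √(n : ℝ) * ‖c n ω - β‖) :
    TendstoInMeasure μ c atTop fun _ => β := by
  refine tendstoInMeasure_iff_probOne.2 (tendsto_iff_norm_sub_tendsto_zero.2 ?_)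
  have h1 : Tendsto (fun p : ℕ × Ω => (√(p.1 : ℝ))⁻¹) (probOne μ) (𝓝 0) :=
    (tendsto_inv_atTop_zero.comp (Real.tendsto_sqrt_atTop.comp
      tendsto_natCast_atTop_atTop)).comp tendsto_fst_probOne
  refine (probOne_mul_tendsto_zero h1 hc).congr' ?_
  filter_upwards [tendsto_fst_probOne.eventually (eventually_gt_atTop 0)] with p hp
  have : √(p.1 : ℝ) ≠ 0 := by positivity
  rw [← mul_assoc, inv_mul_cancel₀ this, one_mul]

theorem matrixTendstoInProb_iff {Ω : Type*} [MeasurableSpace Ω] {K : ℕ} {μ : Measure Ω}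
    {A : ℕ → Ω → Matrix (Fin K) (Fin K) ℝ}
    {A₀ : Matrix (Fin K) (Fin K) ℝ} : MatrixTendstoInProb μ A A₀ ↔
      Tendsto (fun p : ℕ × Ω => A p.1 p.2) (probOne μ) (𝓝 A₀) := by
  simp only [MatrixTendstoInProb, tendstoInMeasure_iff_probOne]
  exact ⟨fun h => tendsto_pi_nhds.2 fun k => tendsto_pi_nhds.2 fun l => h k l,
    fun h k l => tendsto_pi_nhds.1 (tendsto_pi_nhds.1 h k) l⟩

/-! ### Linearization at the root, limit distribution, covariance estimation -/

section Limits

variable {Ω : Type*} [MeasurableSpace Ω] {K : ℕ} {μ : Measure Ω} [IsProbabilityMeasure μ]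
  {v : Form} {δ : ℝ} {X : ℕ → Ω → Vec K} {Y : ℕ → Ω → ℝ}
  {β : Vec K} {L : Vec K ≃L[ℝ] Vec K} {r κ : ℝ}

/-- Linearization of the estimating equation at a consistent root. -/
theorem IsSampling.isEquivalent_root (hs : IsSampling μ X Y)
    (h : IsRegular v δ μ (X 0) (Y 0) β L r) (hU : IsUnit (popDeriv v δ μ (X 0) (Y 0) β))
    {b : ℕ × Ω → Vec K} (hb : Tendsto b (probOne μ) (𝓝 β))
    (h0 : ∀ᶠ p in probOne μ, avgGrad v δ X Y p (b p) = 0) :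
    Asymptotics.IsEquivalent (probOne μ) (fun p => b p - β) fun p =>
      Ring.inverse (popDeriv v δ μ (X 0) (Y 0) β) (-avgGrad v δ X Y p β) := by
  set D := popDeriv v δ μ (X 0) (Y 0) β
  -- The expansion controls the remainder relative to `b - β`; symmetry of asymptotic equivalence
  -- makes it small relative to the linear term, whose size is known.
  refine Asymptotics.IsEquivalent.symm (Asymptotics.isLittleO_iff.2 fun ε hε => ?_)
  obtain ⟨η, hη, hηε⟩ := exists_pos_mul_le (norm_nonneg (Ring.inverse D)) zero_le_one hε
  have hc : ∀ᶠ x in 𝓝 β, ‖popDeriv v δ μ (X 0) (Y 0) x - D‖ < η / 2 := by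
    simpa only [dist_eq_norm] using Metric.continuousAt_iff'.1
      (h.continuousOn_popDeriv.continuousAt (ball_mem_nhds L β h.r_pos)) (η / 2) (half_pos hη)
  obtain ⟨ρ, hρ, hsub⟩ := exists_ball_subset L β (hc.and (ball_mem_nhds L β h.r_pos))
  filter_upwards [h0, hb.eventually (ball_mem_nhds L β hρ),
    hs.avgDeriv_close h.memLp h.dominated (half_pos hη)] with p hp0 hpb hpd
  have h1 := (isC1Limit_avgGrad h.delta_pos (ball L β ρ) p (v := v) (X := X)
    (Y := Y)).norm_sub_sub_le subset_rfl (convex_ball L β ρ) (c := D) (k := η) (fun x hx => by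
      have h2 := hpd x (hsub hx).2
      have h3 : ‖popDeriv v δ μ (X 0) (Y 0) x - D‖ < η / 2 := (hsub hx).1
      calc ‖avgDeriv v δ X Y p x - D‖ ≤ _ := norm_sub_le_norm_sub_add_norm_sub _ _ _
        _ ≤ η := by linarith) hpb (mem_ball_self L β hρ.le)
  rw [hp0, zero_sub] at h1
  have h2 : Ring.inverse D (-avgGrad v δ X Y p β) - (b p - β) =
      Ring.inverse D (-avgGrad v δ X Y p β - D (b p - β)) := by
    rw [map_sub, inverse_apply_apply hU]
  simp only [Pi.sub_apply]
  rw [h2]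
  calc _ ≤ ‖Ring.inverse D‖ * (η * ‖b p - β‖) :=
        (Ring.inverse D).le_opNorm_of_le h1
    _ = ‖Ring.inverse D‖ * η * 1 * ‖b p - β‖ := by ring
    _ ≤ _ := by gcongr

/-- A consistent root of the estimating equation is asymptotically linear. -/
theorem IsSampling.tendsto_sqrt_smul_root (hs : IsSampling μ X Y)
    (h : IsRegular v δ μ (X 0) (Y 0) β L r) (hU : IsUnit (popDeriv v δ μ (X 0) (Y 0) β))
    (hscore : MemLp (score v δ (X 0) (Y 0) β) 2 μ)
    {b : ℕ × Ω → Vec K} (hb : Tendsto b (probOne μ) (𝓝 β))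
    (h0 : ∀ᶠ p in probOne μ, avgGrad v δ X Y p (b p) = 0) :
    Tendsto (fun p => √(p.1 : ℝ) • (b p - β -
      Ring.inverse (popDeriv v δ μ (X 0) (Y 0) β) (-avgGrad v δ X Y p β))) (probOne μ) (𝓝 0) := by
  have h1 := Asymptotics.isLittleO_norm_norm.2 (hs.isEquivalent_root h hU hb h0).isLittleO
  obtain ⟨e, he, heq⟩ := Asymptotics.isLittleO_iff_exists_eq_mul.1 h1
  -- The relative error is `o_p(1)`, and `√n` times the linear term is bounded in probability by the
  -- central limit theorem.
  have h2 := probOne_mul_tendsto_zero he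
    (isBoundedInProb_of_tendstoInDistribution (hs.tendstoInDistribution h hU hscore))
  rw [tendsto_zero_iff_norm_tendsto_zero]
  refine h2.congr' ?_
  filter_upwards [heq] with p hp
  simp only [Pi.sub_apply, Pi.mul_apply] at hp
  rw [norm_smul, norm_smul, hp]
  ring

/-- The asymptotic distribution of an estimator that is asymptotically equivalent to a root of the
estimating equation. -/
theorem IsSampling.tendstoInDistribution_of_near_root (hs : IsSampling μ X Y)
    (h : IsRegular v δ μ (X 0) (Y 0) β L r) (hU : IsUnit (popDeriv v δ μ (X 0) (Y 0) β))
    (hscore : MemLp (score v δ (X 0) (Y 0) β) 2 μ)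
    {b : ℕ × Ω → Vec K} (hb : Tendsto b (probOne μ) (𝓝 β))
    (h0 : ∀ᶠ p in probOne μ, avgGrad v δ X Y p (b p) = 0)
    {c : ℕ → Ω → Vec K} (hcm : ∀ n, AEMeasurable (c n) μ)
    (hc : Tendsto (fun p : ℕ × Ω => √(p.1 : ℝ) • (c p.1 p.2 - b p)) (probOne μ) (𝓝 0)) :
    TendstoInDistribution (fun (n : ℕ) ω => √(n : ℝ) • (c n ω - β)) atTop id
      (fun _ => μ) (multivariateGaussian 0 (asympCov v δ μ (X 0) (Y 0) β)) := by
  refine tendstoInDistribution_of_tendstoInMeasure_sub _ _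
    (hs.tendstoInDistribution h hU hscore) ?_
    fun n => ((hcm n).sub_const β).fun_const_smul _
  refine tendstoInMeasure_iff_probOne.2 ?_
  have := hc.add (hs.tendsto_sqrt_smul_root h hU hscore hb h0)
  rw [add_zero] at this
  refine this.congr fun p => ?_
  simp only [Pi.sub_apply, ← smul_add, ← smul_sub]
  congr 1
  abel

theorem toEuclideanCLM_entry (A : Matrix (Fin K) (Fin K) ℝ) (k l : Fin K) :
    Matrix.toEuclideanCLM (𝕜 := ℝ) A (EuclideanSpace.single l 1) k = A k l := by
  simp [Matrix.ofLp_toEuclideanCLM]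

theorem IsSampling.tendsto_bread (hs : IsSampling μ X Y)
    (h : IsRegular v δ μ (X 0) (Y 0) β L r) {b : ℕ → Ω → Vec K}
    (hb : TendstoInMeasure μ b atTop fun _ => β) :
    Tendsto (fun p : ℕ × Ω => bread v δ (fun i : Fin p.1 => X i p.2) (fun i => Y i p.2) (b p.1 p.2))
      (probOne μ) (𝓝 (popBread v δ μ (X 0) (Y 0) β)) := by
  have h1 := hs.tendsto_avgDeriv h (tendstoInMeasure_iff_probOne.1 hb)
  rw [← toEuclideanCLM_popBread h.integrable_gradDeriv] at h1
  refine tendsto_pi_nhds.2 fun k => tendsto_pi_nhds.2 fun l => ?_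
  have h2 := ((EuclideanSpace.proj (𝕜 := ℝ) k).continuous.tendsto _).comp
    (((ContinuousLinearMap.apply ℝ (Vec K) (EuclideanSpace.single l (1 : ℝ))).continuous.tendsto
      _).comp h1)
  simp only [EuclideanSpace.coe_proj, ContinuousLinearMap.apply_apply, toEuclideanCLM_entry] at h2
  refine h2.congr fun p => ?_
  refine Eq.trans ?_ (toEuclideanCLM_entry (bread v δ (fun i : Fin p.1 => X i p.2)
    (fun i => Y i p.2) (b p.1 p.2)) k l)
  rw [toEuclideanCLM_bread]
  rfl

/-- The sandwich estimator of the asymptotic covariance is consistent. -/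
theorem IsSampling.matrixTendstoInProb_sandwich (hs : IsSampling μ X Y)
    (h : IsRegular v δ μ (X 0) (Y 0) β L r) (hA : (popBread v δ μ (X 0) (Y 0) β).PosDef)
    {b : ℕ → Ω → Vec K} {S : ℕ → Ω → Matrix (Fin K) (Fin K) ℝ}
    (hb : TendstoInMeasure μ b atTop fun _ => β)
    (hS : MatrixTendstoInProb μ S (scoreCov v δ μ (X 0) (Y 0) β)) :
    MatrixTendstoInProb μ (fun n ω => sandwich
        (bread v δ (fun i : Fin n => X i ω) (fun i => Y i ω) (b n ω)) (S n ω))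
      (asympCov v δ μ (X 0) (Y 0) β) := by
  rw [matrixTendstoInProb_iff] at hS ⊢
  have hdet : (popBread v δ μ (X 0) (Y 0) β).det ≠ 0 := hA.det_pos.ne'
  have hinv := (continuousAt_matrix_inv _
    (by rw [Ring.inverse_eq_inv']; exact continuousAt_inv₀ hdet)).tendsto.comp
      (hs.tendsto_bread h hb)
  have hmul : ∀ {A B : ℕ × Ω → Matrix (Fin K) (Fin K) ℝ} {A₀ B₀}, Tendsto A (probOne μ) (𝓝 A₀) →
      Tendsto B (probOne μ) (𝓝 B₀) → Tendsto (fun p => A p * B p) (probOne μ) (𝓝 (A₀ * B₀)) :=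
    fun h1 h2 => ((continuous_fst.matrix_mul continuous_snd).tendsto (_, _)).comp
      (h1.prodMk_nhds h2)
  exact hmul (hmul hinv hS) hinv

theorem IsSampling.exists_root (hs : IsSampling μ X Y)
    (h : IsRegular v δ μ (X 0) (Y 0) β L r) {κ₁ : ℝ} (hκ₁ : 0 ≤ κ₁) (hκ : κ₁ < κ) (hκ1 : κ < 1)
    (hcon : IsContractionOn L κ (popMap v δ μ (X 0) (Y 0)) (ball L β r))
    (hd : ∀ a, ‖L (popMapDeriv v δ μ (X 0) (Y 0) β a)‖ ≤ κ₁ * ‖L a‖) :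
    ∃ (q C : ℝ) (b : ℕ × Ω → Vec K), 0 < q ∧ q < κ ∧ Tendsto b (probOne μ) (𝓝 β) ∧
      ∀ᶠ p in probOne μ, avgGrad v δ X Y p (b p) = 0 ∧ ∀ b₀ ∈ ball L β r, ∀ t,
        ‖iter v δ (fun i : Fin p.1 => X i p.2) (fun i => Y i p.2) b₀ t - b p‖ ≤ C * q ^ t := by
  obtain ⟨q, C, C', hq, hqκ, hev⟩ := hs.exists_rate h hκ₁ hκ hκ1 hcon hd
  -- The root is picked separately for each sample size and outcome, with no measurability claimed.
  obtain ⟨b, hb⟩ := hev.choice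
  refine ⟨q, C, b, hq, hqκ, ?_, hb.mono fun p hp => ⟨hp.1, hp.2.2⟩⟩
  have h1 := (hs.tendsto_avgGrad_self h).norm.const_mul C'
  rw [norm_zero, mul_zero] at h1
  exact tendsto_iff_norm_sub_tendsto_zero.2
    (squeeze_zero' (Eventually.of_forall fun p => norm_nonneg _) (hb.mono fun p hp => hp.2.1) h1)

/-- Asymptotics of the iterations, on a ball on which the population map is a contraction. -/
theorem IsSampling.asymptotics (hs : IsSampling μ X Y)
    (h : IsRegular v δ μ (X 0) (Y 0) β L r) (hscore : MemLp (score v δ (X 0) (Y 0) β) 2 μ)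
    {k₀ : Fin K} (hconst : ∀ ω, X 0 ω k₀ = 1) (hκ0 : 0 < κ) (hκ1 : κ < 1)
    (hcon : IsContractionOn L κ (popMap v δ μ (X 0) (Y 0)) (ball L β r))
    {b₀ : ℕ → Ω → Vec K} (hb₀m : ∀ n, AEMeasurable (b₀ n) μ)
    (hb₀ : WithProbTendingToOne μ fun n ω => b₀ n ω ∈ ball L β r) :
    WithProbTendingToOne μ (fun n ω => ∃ b,
      Tendsto (iter v δ (fun i : Fin n => X i ω) (fun i => Y i ω) (b₀ n ω)) atTop (𝓝 b) ∧
      IsPoissonEstimate v (fun i : Fin n => X i ω) (fun i => Y i ω) b ∧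
      ∀ b', IsPoissonEstimate v (fun i : Fin n => X i ω) (fun i => Y i ω) b' → b' = b) ∧
    (popBread v δ μ (X 0) (Y 0) β).PosDef ∧
    ∀ t : ℕ → ℕ, (∀ n : ℕ, -(1 / 2) * Real.log (n : ℝ) / Real.log κ ≤ (t n : ℝ)) →
      TendstoInDistribution (fun (n : ℕ) ω => √(n : ℝ) •
          (iter v δ (fun i : Fin n => X i ω) (fun i => Y i ω) (b₀ n ω) (t n) - β)) atTop id
        (fun _ => μ) (multivariateGaussian 0 (asympCov v δ μ (X 0) (Y 0) β)) := by
  obtain ⟨κ₁, hκ₁, hκ, hd⟩ := h.exists_lt_modulus hconst hκ0 hκ1 hcon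
  have hU : IsUnit (popDeriv v δ μ (X 0) (Y 0) β) := isUnit_popDeriv (hκ.trans hκ1) hd
  obtain ⟨q, C, b, hq, hqκ, hb, hroot⟩ := hs.exists_root h hκ₁ hκ hκ1 hcon hd
  rw [← eventually_probOne (p := fun p => b₀ p.1 p.2 ∈ ball L β r)] at hb₀
  refine ⟨?_, h.popBread_posDef hU, fun t ht => ?_⟩
  · refine (eventually_probOne (p := fun p => ∃ b,
      Tendsto (iter v δ (fun i : Fin p.1 => X i p.2) (fun i => Y i p.2) (b₀ p.1 p.2)) atTop (𝓝 b) ∧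
      IsPoissonEstimate v (fun i : Fin p.1 => X i p.2) (fun i => Y i p.2) b ∧
      ∀ b', IsPoissonEstimate v (fun i : Fin p.1 => X i p.2) (fun i => Y i p.2) b' → b' = b)).1 ?_
    -- The case `n = 0` is excluded because the average of the empty sample is zero by convention.
    filter_upwards [hroot, hb₀, hs.eventually_unique h hU,
      tendsto_fst_probOne.eventually (eventually_gt_atTop 0)] with p hp hpb hpu hp0
    have hP := (sum_grad_eq_zero_iff_isPoissonEstimate h.delta_pos _ _ _).1
      ((sum_grad_eq_zero_iff_avgGrad hp0.ne' _).2 hp.1)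
    refine ⟨b p, ?_, hP, fun b' hb' => hpu _ _ hP hb'⟩
    have h1 := (tendsto_pow_atTop_nhds_zero_of_lt_one hq.le (hqκ.trans hκ1)).const_mul C
    rw [mul_zero] at h1
    exact tendsto_iff_norm_sub_tendsto_zero.2
      (squeeze_zero (fun _ => norm_nonneg _) (hp.2 _ hpb) h1)
  · refine hs.tendstoInDistribution_of_near_root h hU hscore hb (hroot.mono fun p hp => hp.1)
      (fun n => aemeasurable_iter v δ (fun i => hs.measurable_X i) (fun i => hs.measurable_Y i)
        (hb₀m n) (t n)) ?_
    have h1 := ((tendsto_sqrt_mul_pow hq hqκ hκ1 ht).comp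
      (tendsto_fst_probOne (μ := μ))).const_mul C
    rw [mul_zero] at h1
    refine squeeze_zero_norm' ?_ h1
    filter_upwards [hroot, hb₀] with p hp hpb
    rw [norm_smul, Real.norm_of_nonneg (Real.sqrt_nonneg _), Function.comp_apply, mul_left_comm]
    gcongr
    exact hp.2 _ hpb _

end Limits

end IOLS
-- The main theorem
theorem theorem3
    {Ω : Type*} [MeasurableSpace Ω] (μ : Measure Ω) [IsProbabilityMeasure μ]
    {K : ℕ} (v : IOLS.Form) (δ : ℝ) (hδ : 0 < δ)
    -- the data: `Y i = exp (X i ' β) * U i`, with `(X i, U i)` iid and `U i ≥ 0`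
    (β : IOLS.Vec K) (X : ℕ → Ω → IOLS.Vec K) (U Y : ℕ → Ω → ℝ)
    (hY : ∀ i, Y i = IOLS.response β (X i) (U i))
    (hU : ∀ i ω, 0 ≤ U i ω)
    (hXmeas : ∀ i, Measurable (X i)) (hUmeas : ∀ i, Measurable (U i))
    (hindep : iIndepFun (fun i ω => (X i ω, U i ω)) μ)
    (hident : ∀ i, IdentDistrib (fun ω => (X i ω, U i ω)) (fun ω => (X 0 ω, U 0 ω)) μ μ)
    -- `X` contains a constant, has finite second moments, and no perfect collinearity
    (k₀ : Fin K) (hconst : ∀ i ω, X i ω k₀ = 1)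
    (hX2 : MemLp (X 0) 2 μ)
    (hrank : (IOLS.secondMoment μ (X 0)).PosDef)
    -- Poisson condition: `E[X (U - 1)] = 0` (MP), `E[X (Y - exp (X ' β))] = 0` (AP)
    (hexog : ∫ ω, IOLS.err v (Y 0 ω) (inner ℝ (X 0 ω) β) • X 0 ω ∂μ = 0)
    -- the score has finite second moments
    (hscore : MemLp (IOLS.score v δ (X 0) (Y 0) β) 2 μ) :
    -- in every sample of full column rank, the iterations can only settle at a Poisson estimate
    (∀ (n : ℕ) (x : Fin n → IOLS.Vec K) (y : Fin n → ℝ), (∀ i, 0 ≤ y i) →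
      (IOLS.design x).rank = K →
      (∀ b, IOLS.step v δ x y b = b ↔ IOLS.IsPoissonEstimate v x y b) ∧
      ∀ b₀ b, Tendsto (IOLS.iter v δ x y b₀) atTop (𝓝 b) → IOLS.IsPoissonEstimate v x y b) ∧
    -- weights between 0 and 1 suffice for a contraction near `β`, for prewhitened covariates
    (∀ (L : IOLS.Vec K ≃L[ℝ] IOLS.Vec K) (r : ℝ), 0 < r →
      IOLS.DominatedOn v δ μ (X 0) (Y 0) (IOLS.ball L β r) →
      (∀ᵐ ω ∂μ, 0 ≤ IOLS.weight v δ (Y 0 ω) (inner ℝ (X 0 ω) β)) →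
      (IOLS.popBread v δ μ (X 0) (Y 0) β).PosDef →
      ∃ (L' : IOLS.Vec K ≃L[ℝ] IOLS.Vec K) (r' κ : ℝ), 0 < r' ∧ 0 < κ ∧ κ < 1 ∧
        (∀ a, ‖L' a‖ ^ 2 = ∫ ω, (inner ℝ (X 0 ω) a) ^ 2 ∂μ) ∧
        IOLS.ball L' β r' ⊆ IOLS.ball L β r ∧
        IOLS.IsContractionOn L' κ (IOLS.popMap v δ μ (X 0) (Y 0)) (IOLS.ball L' β r')) ∧
    -- asymptotics, whenever `M` is a contraction with modulus `κ` on a ball around `β`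
    -- that contains the initial estimate
    (∀ (L : IOLS.Vec K ≃L[ℝ] IOLS.Vec K) (r κ : ℝ), 0 < r → 0 < κ → κ < 1 →
      IOLS.DominatedOn v δ μ (X 0) (Y 0) (IOLS.ball L β r) →
      IOLS.IsContractionOn L κ (IOLS.popMap v δ μ (X 0) (Y 0)) (IOLS.ball L β r) →
      ∀ b₀ : ℕ → Ω → IOLS.Vec K, (∀ n, AEMeasurable (b₀ n) μ) →
      IOLS.WithProbTendingToOne μ (fun n ω => b₀ n ω ∈ IOLS.ball L β r) →
      -- the iterations converge to the Poisson estimate, which is unique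
      IOLS.WithProbTendingToOne μ (fun n ω =>
        ∃ b, Tendsto (IOLS.iter v δ (fun i : Fin n => X i ω) (fun i => Y i ω) (b₀ n ω)) atTop (𝓝 b) ∧
          IOLS.IsPoissonEstimate v (fun i : Fin n => X i ω) (fun i => Y i ω) b ∧
          ∀ b', IOLS.IsPoissonEstimate v (fun i : Fin n => X i ω) (fun i => Y i ω) b' → b' = b) ∧
      -- the matrix inverted in the asymptotic covariance is nonsingular
      (IOLS.popBread v δ μ (X 0) (Y 0) β).PosDef ∧
      ∀ t : ℕ → ℕ, (∀ n : ℕ, -(1 / 2) * Real.log (n : ℝ) / Real.log κ ≤ (t n : ℝ)) →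
        ∀ bhat : ℕ → Ω → IOLS.Vec K,
        (∀ n ω, bhat n ω =
          IOLS.iter v δ (fun i : Fin n => X i ω) (fun i => Y i ω) (b₀ n ω) (t n)) →
        -- consistency, root-n rate, asymptotic normality
        TendstoInMeasure μ bhat atTop (fun _ => β) ∧
        IOLS.IsBoundedInProb μ (fun n ω => Real.sqrt n * ‖bhat n ω - β‖) ∧
        TendstoInDistribution (fun (n : ℕ) ω => Real.sqrt n • (bhat n ω - β)) atTop id
          (fun _ => μ)
          (multivariateGaussian 0 (IOLS.asympCov v δ μ (X 0) (Y 0) β)) ∧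
        -- consistent estimation of the covariance, with the weights at any `b n` that
        -- converges in probability to `β` (such as `β` itself or `bhat n`), and any consistent estimate of the covariance of the score
        ∀ (b : ℕ → Ω → IOLS.Vec K) (S : ℕ → Ω → Matrix (Fin K) (Fin K) ℝ),
          TendstoInMeasure μ b atTop (fun _ => β) →
          IOLS.MatrixTendstoInProb μ S (IOLS.scoreCov v δ μ (X 0) (Y 0) β) →
          IOLS.MatrixTendstoInProb μ
            (fun n ω => IOLS.sandwich
              (IOLS.bread v δ (fun i : Fin n => X i ω) (fun i => Y i ω) (b n ω)) (S n ω))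
            (IOLS.asympCov v δ μ (X 0) (Y 0) β)) := by
  have hYeq : Y = fun i => IOLS.response β (X i) (U i) := funext hY
  -- The observed pair `(X, Y)` is one fixed measurable function of `(X, U)`, so it is again iid.
  set Ψ : IOLS.Vec K × ℝ → IOLS.Vec K × ℝ := fun q => (q.1, Real.exp (inner ℝ q.1 β) * q.2) with hΨ
  have hΨm : Measurable Ψ := by fun_prop
  have hXY : ∀ i, (fun ω => (X i ω, Y i ω)) = Ψ ∘ fun ω => (X i ω, U i ω) := fun i => by
    funext ω
    simp [hΨ, hYeq, IOLS.response]
  have hs : IOLS.IsSampling μ X Y :=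
    { measurable_X := hXmeas
      measurable_Y := fun i => by
        rw [hYeq]
        exact (Real.measurable_exp.comp ((hXmeas i).inner measurable_const)).mul (hUmeas i)
      nonneg := fun i ω => by
        rw [hYeq]
        exact mul_nonneg (Real.exp_pos _).le (hU i ω)
      indep := by
        rw [show (fun i ω => (X i ω, Y i ω)) = fun i => Ψ ∘ fun ω => (X i ω, U i ω) from
          funext hXY]
        exact hindep.comp (fun _ => Ψ) fun _ => hΨm
      ident := fun i => by
        rw [hXY, hXY]
        exact (hident i).comp hΨm }
  have hscore1 : Integrable (IOLS.score v δ (X 0) (Y 0) β) μ := hscore.integrable (by norm_num)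
  have hreg : ∀ (L : IOLS.Vec K ≃L[ℝ] IOLS.Vec K) (r : ℝ), 0 < r →
      IOLS.DominatedOn v δ μ (X 0) (Y 0) (IOLS.ball L β r) →
      IOLS.IsRegular v δ μ (X 0) (Y 0) β L r := fun L r hr hdom =>
    { delta_pos := hδ
      r_pos := hr
      measurable_X := hXmeas 0
      measurable_Y := hs.measurable_Y 0
      nonneg := hs.nonneg 0
      memLp := hX2
      posDef := hrank
      exog := hexog
      score := hscore1
      dominated := hdom
      isC1Limit := hs.isC1Limit_popGrad hδ hr hX2 hdom hscore1 }
  refine ⟨fun n x y hy hx => IOLS.fixedPoint_iff_and_limit hδ x y hy hx,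
    fun L r hr hdom hw hA => (hreg L r hr hdom).exists_contraction hw hA,
    fun L r κ hr hκ0 hκ1 hdom hcon b₀ hb₀m hb₀ => ?_⟩
  have h := hreg L r hr hdom
  obtain ⟨h1, h2, h3⟩ := hs.asymptotics h hscore (hconst 0) hκ0 hκ1 hcon hb₀m hb₀
  refine ⟨h1, h2, fun t ht bhat hbhat => ?_⟩
  have h4 := h3 t ht
  simp only [← hbhat] at h4
  -- The rate follows from tightness of the normal limit, and consistency from the rate.
  have h5 := IOLS.isBoundedInProb_of_tendstoInDistribution h4
  simp only [norm_smul, Real.norm_of_nonneg (Real.sqrt_nonneg _)] at h5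
  exact ⟨IOLS.tendstoInMeasure_of_isBoundedInProb h5, h5, h4,
    fun b S hb hS => hs.matrixTendstoInProb_sandwich h h2 hb hS⟩
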